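/- Let $k\ge 2$ be an even integer, $\nu=\frac1{k+2}$, and consider $y''(t)+t^k y(t)=0$ on $\mathbb{R}$. For $x>0$ let $$J_{\mu}(x)=\left(\tfrac x2\right)^{\mu}\sum_{n\ge0}\frac{(-1)^n}{\Gamma(n+1)\Gamma(n+\mu+1)}\left(\tfrac x2\right)^{2n},\qquad Y_\nu(x)=\cot(\pi\nu)J_\nu(x)-\csc(\pi\nu)J_{-\nu}(x)$$ be the Bessel functions, and put $z(t)=\frac{t^{1+k/2}}{1+k/2}$ for $t>0$. Define $$u(t)=\begin{cases}\sqrt{\frac{\pi t}{2+k}}\,J_\nu(z(t)) & t>0\\ -\sqrt{\frac{-\pi t}{2+k}}\,J_\nu(z(-t)) & t<0\end{cases}\qquad v(t)=\begin{cases}\sqrt{\frac{\pi t}{2+k}}\,Y_\nu(z(t)) & t>0\\ -2\cot(\pi\nu)\sqrt{\frac{-\pi t}{2+k}}\,J_\nu(z(-t))+\sqrt{\frac{-\pi t}{2+k}}\,Y_\nu(z(-t)) & t<0\end{cases}$$ and $u(0)=0$, $v(0)=-\sqrt{\frac{\pi}{2+k}}\,\frac{\nu^{-\nu}\Gamma(\nu)}{\pi}$.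 For real $c_1,c_2$ let $m_{c_1,c_2}=c_1^2u^2+c_2^2v^2$. A real function $f$ is called *nonoscillatory on an interval* $I$ if finitely many points cut $I$ into subintervals on each of which $f$ is monotone, and *nonoscillatory as $t\to\pm\infty$* if it is asymptotically equivalent there to an eventually monotone function (this is implied by being nonoscillatory on a half line). A *phase function* on $\mathbb{R}$ is a real $C^3$ function $\alpha$ with $\alpha'$ nowhere zero that satisfies Kummer's equation $$t^k-(\alpha')^2+\tfrac34\left(\tfrac{\alpha''}{\alpha'}\right)^2-\tfrac{\alpha'''}{2\alpha'}=0 ;$$ it is called nonoscillatory if $\alpha'$ is. Then: 1. $u$ and $v$ are $C^\infty$ on $\mathbb{R}$, solve the equation on $\mathbb{R}$, have Wronskian $uv'-u'v=1$, and form a basis of the space of solutions. 2. For all real $c_1,c_2$, as $t\to+\infty$, $$m_{c_1,c_2}(t)=t^{-k/2}\left(c_1^2\sin^2\left(\tfrac{k\pi+8t^{1+k/2}}{8+4k}\right)+c_2^2\cos^2\left(\tfrac{k\pi+8t^{1+k/2}}{8+4k}\right)+o(1)\right).$$ 3. As $t\to-\infty$, $$m_{1,1}(t)\sim\tfrac12(-t)^{-k/2}\csc^2\left(\tfrac{\pi}{k+2}\right)\left(-4\cos\left(\tfrac{\pi}{k+2}\right)\sin\left(\tfrac{4t(-t)^{k/2}}{k+2}\right)+\cos\left(\tfrac{2\pi}{k+2}\right)+3\right).$$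 4. Let $(c_1,c_2)\ne(0,0)$ be real. Then $m_{c_1,c_2}$ is nonoscillatory as $t\to+\infty$ if and only if $c_1^2=c_2^2$. If $c_1^2=c_2^2$, then $m_{c_1,c_2}$ is not nonoscillatory as $t\to-\infty$. Hence $m_{c_1,c_2}$ is not nonoscillatory on both $(0,\infty)$ and $(-\infty,0)$. 5. No phase function on $\mathbb{R}$ is nonoscillatory both as $t\to+\infty$ and as $t\to-\infty$; in particular, none is nonoscillatory on the whole real line. -/

import Mathlib

open Set Filter Topology Asymptotics
open scoped ContDiff

noncomputable section

/-- The Bessel function of the first kind `J_ν(x)` for real order `ν` and real `x > 0`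
(`Real.Gamma` is `0` at its poles, which gives the usual convention `1/Γ = 0` there). -/
def besselJ (ν x : ℝ) : ℝ :=
  (x / 2) ^ ν * ∑' n : ℕ, (-1 : ℝ) ^ n /
    (Real.Gamma ((n : ℝ) + 1) * Real.Gamma ((n : ℝ) + ν + 1)) * (x / 2) ^ (2 * n)

/-- The Bessel function of the second kind `Y_ν(x)` for real non-integer order `ν` and `x > 0`. -/
def besselY (ν x : ℝ) : ℝ :=
  Real.cot (Real.pi * ν) * besselJ ν x - (Real.sin (Real.pi * ν))⁻¹ * besselJ (-ν) x

/-- The order `1 / (k + 2)` of the Bessel functions attached to `y'' + t ^ k y = 0`. -/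
def besselOrder (k : ℕ) : ℝ := 1 / (2 + (k : ℝ))

/-- The first basis function; the value `0` at `t = 0` is the limit of the two formulas. -/
def uEven (k : ℕ) (t : ℝ) : ℝ :=
  if 0 < t then
    √(Real.pi * t / (2 + k)) *
      besselJ (besselOrder k) (t ^ (1 + (k : ℝ) / 2) / (1 + (k : ℝ) / 2))
  else if t < 0 then
    -(√(-(Real.pi * t) / (2 + k)) *
      besselJ (besselOrder k) ((-t) ^ (1 + (k : ℝ) / 2) / (1 + (k : ℝ) / 2)))
  else 0

/-- The second basis function; the value at `t = 0` is the limit of the two formulas, namely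
`√(π / (2 + k)) · (-ν ^ (-ν) Γ(ν) / π)` with `ν = 1 / (k + 2)`. -/
def vEven (k : ℕ) (t : ℝ) : ℝ :=
  if 0 < t then
    √(Real.pi * t / (2 + k)) *
      besselY (besselOrder k) (t ^ (1 + (k : ℝ) / 2) / (1 + (k : ℝ) / 2))
  else if t < 0 then
    -(2 * Real.cot (Real.pi * besselOrder k) * √(-(Real.pi * t) / (2 + k)) *
      besselJ (besselOrder k) ((-t) ^ (1 + (k : ℝ) / 2) / (1 + (k : ℝ) / 2))) +
    √(-(Real.pi * t) / (2 + k)) *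
      besselY (besselOrder k) ((-t) ^ (1 + (k : ℝ) / 2) / (1 + (k : ℝ) / 2))
  else
    √(Real.pi / (2 + k)) *
      (-(besselOrder k ^ (-besselOrder k) * Real.Gamma (besselOrder k) / Real.pi))

/-- The modulus function of the pair `c₁ u, c₂ v`. -/
def modulusEven (k : ℕ) (c₁ c₂ t : ℝ) : ℝ :=
  c₁ ^ 2 * (uEven k t) ^ 2 + c₂ ^ 2 * (vEven k t) ^ 2

/-- `y` is a (twice differentiable) solution of `y'' + q y = 0` on the real line. -/
def IsSolution (q y : ℝ → ℝ) : Prop :=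
  Differentiable ℝ y ∧ ∀ t, HasDerivAt (deriv y) (-(q t * y t)) t

/-- `α` is a phase function on the real line for `y'' + q y = 0`, that is, a real-valued
solution of Kummer's equation whose derivative does not vanish. -/
structure IsPhaseFunction (q α : ℝ → ℝ) : Prop where
  contDiff : ContDiff ℝ 3 α
  deriv_ne_zero : ∀ t, deriv α t ≠ 0
  kummer : ∀ t, q t - (deriv α t) ^ 2
    + 3 / 4 * (iteratedDeriv 2 α t / deriv α t) ^ 2
    - iteratedDeriv 3 α t / (2 * deriv α t) = 0

/-- `f` is nonoscillatory on the interval `I`: finitely many points cut `I` into subintervals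
on each of which `f` is monotone. -/
def NonoscillatoryOn (f : ℝ → ℝ) (I : Set ℝ) : Prop :=
  ∃ F : Finset ℝ, ∀ J ⊆ I, J.OrdConnected → Disjoint J (F : Set ℝ) →
    MonotoneOn f J ∨ AntitoneOn f J

/-- `f` is nonoscillatory, to leading order, along `l` (in practice `atTop` or `atBot`): it is
asymptotically equivalent to an eventually monotone function. This is implied by being
nonoscillatory on a half line, see `NonoscillatoryOn.atTop` and `NonoscillatoryOn.atBot`. -/
def NonoscillatoryAt (f : ℝ → ℝ) (l : Filter ℝ) : Prop :=
  ∃ g : ℝ → ℝ, (∃ s ∈ l, MonotoneOn g s ∨ AntitoneOn g s) ∧ f ~[l] g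

theorem NonoscillatoryOn.mono {f : ℝ → ℝ} {I I' : Set ℝ} (h : NonoscillatoryOn f I)
    (hI : I' ⊆ I) : NonoscillatoryOn f I' := by
  obtain ⟨F, hF⟩ := h
  exact ⟨F, fun J hJ => hF J (hJ.trans hI)⟩

theorem NonoscillatoryOn.atTop {f : ℝ → ℝ} {a : ℝ} (h : NonoscillatoryOn f (Ioi a)) :
    NonoscillatoryAt f atTop := by
  obtain ⟨F, hF⟩ := h
  obtain ⟨M, hM⟩ := F.bddAbove
  refine ⟨f, ⟨Ioi (max a M), Ioi_mem_atTop _, ?_⟩, IsEquivalent.refl⟩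
  refine hF _ (Ioi_subset_Ioi (le_max_left _ _)) ordConnected_Ioi ?_
  rw [Set.disjoint_left]
  intro x hx hxF
  exact absurd (hM hxF) (not_le.mpr (lt_of_le_of_lt (le_max_right _ _) hx))

theorem NonoscillatoryOn.atBot {f : ℝ → ℝ} {a : ℝ} (h : NonoscillatoryOn f (Iio a)) :
    NonoscillatoryAt f atBot := by
  obtain ⟨F, hF⟩ := h
  obtain ⟨M, hM⟩ := F.bddBelow
  refine ⟨f, ⟨Iio (min a M), Iio_mem_atBot _, ?_⟩, IsEquivalent.refl⟩
  refine hF _ (Iio_subset_Iio (min_le_left _ _)) ordConnected_Iio ?_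
  rw [Set.disjoint_left]
  intro x hx hxF
  exact absurd (hM hxF) (not_le.mpr (lt_of_lt_of_le hx (min_le_right _ _)))

end

/-!
With `ν = 1 / (k + 2)`, the two Bessel expressions `√(π t / (2 + k)) J_{±ν}(z(t))` on `t > 0` are
entire functions of `t`: `airyOdd k`, which is odd, and `airyEven k`, which is even. Hence
`u = airyOdd k` and `v = cot (π ν) airyOdd k - csc (π ν) airyEven k` on the whole line, and
smoothness, the differential equation and the Wronskian are read off from power series. All that
is used of the series is `E_μ' = -E_{μ + 1}` and the three-term recurrence
`besselEntire_recurrence`. Moreover the behaviour at `-∞` reduces to the one at `+∞` by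
`u(-t) = -u(t)` and `v(-t) = v(t) - 2 cot (π ν) u(t)`.

The analytic heart is the leading behaviour of `J_{±ν}` at `+∞`. Poisson's integral
`besselEntire_eq_integral` expresses `J_{a - 1/2}` by the integral of
`(1 - s ^ 2) ^ (a - 1) cos (x s)` over `[0, 1]`, which is governed by the endpoint `s = 1`
(`tendsto_rpow_mul_integral_rpow_mul_cexp`). The constant and the phase come from the
conditionally convergent integral of `r ^ (a - 1) exp (-I r)` over `(0, ∞)`, with value
`Γ(a) exp (-I π a / 2)` (`tendsto_integral_rpow_mul_cexp_neg_I`), the boundary case of the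
Laplace transform of `r ^ (a - 1)`. The result is `t ^ (k / 4) u = sin ψ + o(1)` and
`t ^ (k / 4) v = -cos ψ + o(1)` with `ψ = oscPhase k`, whence the asymptotics of all quadratic
forms in `u` and `v` (`tendsto_rpow_mul_quadratic`) and of the modulus functions.

A function asymptotic to `t ^ (-κ)` times a nonconstant trigonometric polynomial of
`c t ^ β + d` is not asymptotic to a monotone function (`coeff_eq_zero_of_antitoneOn`). So a
quadratic form in `u` and `v` that is nonoscillatory at `+∞` is a multiple of `u ^ 2 + v ^ 2`
(`eq_of_nonoscillatoryAt_quadratic`), and this one oscillates at `-∞` because `cot (π ν) ≠ 0`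
(`not_nonoscillatoryAt_atBot`). For a phase function `α`, the reciprocal `1 / |α'|` is the sum of
the squares of the solutions `cos α / √|α'|` and `sin α / √|α'|`, that is, such a quadratic form.
-/

noncomputable section

/-! ### The entire function behind the Bessel functions -/

/-- The coefficients of the entire function `besselEntire μ`. -/
def besselCoeff (μ : ℝ) (n : ℕ) : ℝ :=
  (-1 : ℝ) ^ n / (Real.Gamma ((n : ℝ) + 1) * Real.Gamma ((n : ℝ) + μ + 1))

/-- The entire function `E_μ` with `J_μ(x) = (x / 2) ^ μ * E_μ((x / 2) ^ 2)`. -/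
def besselEntire (μ w : ℝ) : ℝ := ∑' n : ℕ, besselCoeff μ n * w ^ n

theorem besselJ_eq_rpow_mul_besselEntire (μ x : ℝ) :
    besselJ μ x = (x / 2) ^ μ * besselEntire μ ((x / 2) ^ 2) := by
  simp only [besselJ, besselEntire, besselCoeff, pow_mul]

theorem besselCoeff_ne_zero {μ : ℝ} (hμ : -1 < μ) (n : ℕ) : besselCoeff μ n ≠ 0 := by
  have hn : (0 : ℝ) ≤ n := n.cast_nonneg
  have h1 : 0 < Real.Gamma ((n : ℝ) + 1) := Real.Gamma_pos_of_pos (by linarith)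
  have h2 : 0 < Real.Gamma ((n : ℝ) + μ + 1) := Real.Gamma_pos_of_pos (by linarith)
  exact div_ne_zero (pow_ne_zero _ (by norm_num)) (mul_pos h1 h2).ne'

theorem besselCoeff_add_one_param {μ : ℝ} (hμ : -1 < μ) (n : ℕ) :
    ((n : ℝ) + μ + 1) * besselCoeff (μ + 1) n = besselCoeff μ n := by
  have hn : (0 : ℝ) ≤ n := n.cast_nonneg
  have h1 : 0 < Real.Gamma ((n : ℝ) + 1) := Real.Gamma_pos_of_pos (by linarith)
  have h2 : 0 < Real.Gamma ((n : ℝ) + μ + 1) := Real.Gamma_pos_of_pos (by linarith)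
  have h3 : 0 < (n : ℝ) + μ + 1 := by linarith
  have e : (n : ℝ) + (μ + 1) + 1 = ((n : ℝ) + μ + 1) + 1 := by ring
  rw [besselCoeff, besselCoeff, e, Real.Gamma_add_one h3.ne']
  field_simp

theorem besselCoeff_succ (μ : ℝ) (n : ℕ) :
    ((n : ℝ) + 1) * besselCoeff μ (n + 1) = -besselCoeff (μ + 1) n := by
  have hn : (0 : ℝ) ≤ n := n.cast_nonneg
  have h1 : 0 < Real.Gamma ((n : ℝ) + 1) := Real.Gamma_pos_of_pos (by linarith)
  have h3 : 0 < (n : ℝ) + 1 := by linarith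
  have e : (n : ℝ) + 1 + μ + 1 = (n : ℝ) + (μ + 1) + 1 := by ring
  rw [besselCoeff, besselCoeff, Nat.cast_add, Nat.cast_one, e, Real.Gamma_add_one h3.ne', pow_succ]
  field_simp

/-- The radius of convergence is infinite, by the ratio test. -/
theorem summable_besselCoeff_mul_pow {μ : ℝ} (hμ : -1 < μ) (w : ℝ) :
    Summable fun n => besselCoeff μ n * w ^ n := by
  rcases eq_or_ne w 0 with rfl | hw
  · refine summable_of_ne_finset_zero (s := {0}) fun n hn => ?_
    simp [zero_pow (by simpa using hn : n ≠ 0)]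
  refine summable_of_ratio_test_tendsto_lt_one zero_lt_one
    (.of_forall fun n => mul_ne_zero (besselCoeff_ne_zero hμ n) (pow_ne_zero _ hw)) ?_
  have key : ∀ n : ℕ, ‖besselCoeff μ (n + 1) * w ^ (n + 1)‖ / ‖besselCoeff μ n * w ^ n‖ =
      |w| * (1 / ((n : ℝ) + 1)) * (1 / ((n : ℝ) + (μ + 1))) := by
    intro n
    have hn : (0 : ℝ) ≤ n := n.cast_nonneg
    have h0 := besselCoeff_ne_zero (show -1 < μ + 1 by linarith) n
    have h3 : 0 < (n : ℝ) + μ + 1 := by linarith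
    have h4 : 0 < (n : ℝ) + 1 := by linarith
    have e1 : besselCoeff μ (n + 1) = -besselCoeff (μ + 1) n / ((n : ℝ) + 1) := by
      rw [← besselCoeff_succ]; field_simp
    rw [e1, ← besselCoeff_add_one_param hμ, pow_succ, ← add_assoc]
    simp only [norm_mul, norm_div, norm_neg, Real.norm_eq_abs, abs_of_pos h3, abs_of_pos h4]
    have := abs_pos.2 h0
    have := abs_pos.2 (pow_ne_zero n hw)
    field_simp
  simp_rw [key]
  have t1 : Tendsto (fun n : ℕ => 1 / ((n : ℝ) + 1)) atTop (𝓝 0) :=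
    tendsto_one_div_add_atTop_nhds_zero_nat
  have t2 : Tendsto (fun n : ℕ => 1 / ((n : ℝ) + (μ + 1))) atTop (𝓝 0) :=
    (tendsto_atTop_add_const_right _ _ tendsto_natCast_atTop_atTop).const_div_atTop 1
  simpa using (t1.const_mul |w|).mul t2

theorem hasDerivAt_besselEntire {μ : ℝ} (hμ : -1 < μ) (w : ℝ) :
    HasDerivAt (besselEntire μ) (-besselEntire (μ + 1) w) w := by
  have hμ' : -1 < μ + 1 := by linarith
  have hterm : ∀ (n : ℕ) (y : ℝ), besselCoeff μ (n + 1) * (((n + 1 : ℕ) : ℝ) * y ^ (n + 1 - 1)) =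
      -(besselCoeff (μ + 1) n * y ^ n) := by
    intro n y
    have := besselCoeff_succ μ n
    push_cast [Nat.add_sub_cancel]
    linear_combination y ^ n * this
  -- On the ball of radius `R` the differentiated series is dominated by its values at `R`.
  set R := |w| + 1 with hR
  have hu : Summable fun n : ℕ => ‖besselCoeff μ n * ((n : ℝ) * R ^ (n - 1))‖ := by
    rw [← summable_nat_add_iff 1]
    simp_rw [hterm, norm_neg]
    exact (summable_besselCoeff_mul_pow hμ' R).norm
  have hmem : w ∈ Metric.ball (0 : ℝ) R := by
    rw [mem_ball_zero_iff, Real.norm_eq_abs]; linarith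
  have hmain := hasDerivAt_tsum_of_isPreconnected (g := fun n z => besselCoeff μ n * z ^ n)
    (g' := fun n z => besselCoeff μ n * ((n : ℝ) * z ^ (n - 1))) hu Metric.isOpen_ball
    (convex_ball (0 : ℝ) R).isPreconnected
    (fun n y _ => (hasDerivAt_pow n y).const_mul _) ?_ hmem (summable_besselCoeff_mul_pow hμ w) hmem
  · convert! hmain using 1
    have hs : Summable fun n : ℕ => besselCoeff μ n * ((n : ℝ) * w ^ (n - 1)) := by
      rw [← summable_nat_add_iff 1]
      simp_rw [hterm]
      exact (summable_besselCoeff_mul_pow hμ' w).neg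
    rw [hs.tsum_eq_zero_add]
    simp_rw [hterm]
    rw [tsum_neg]
    simp [besselEntire]
  · intro n y hy
    rw [mem_ball_zero_iff] at hy
    have hR0 : 0 ≤ R := by positivity
    rw [norm_mul, norm_mul, norm_mul, norm_mul, norm_pow, norm_pow, Real.norm_of_nonneg hR0]
    gcongr

/-- Induction over the order of smoothness, for all `μ` at once, as `E_μ' = -E_{μ + 1}`. -/
theorem contDiff_besselEntire {μ : ℝ} (hμ : -1 < μ) : ContDiff ℝ ∞ (besselEntire μ) := by
  rw [contDiff_infty]
  intro n
  induction n generalizing μ with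
  | zero =>
    exact contDiff_zero.2
      (continuous_iff_continuousAt.2 fun w => (hasDerivAt_besselEntire hμ w).continuousAt)
  | succ n ih =>
    have hd : deriv (besselEntire μ) = fun w => -besselEntire (μ + 1) w :=
      funext fun w => (hasDerivAt_besselEntire hμ w).deriv
    have := contDiff_succ_iff_deriv (𝕜 := ℝ) (n := (n : WithTop ℕ∞)) (f := besselEntire μ)
    push_cast
    refine this.2 ⟨fun w => (hasDerivAt_besselEntire hμ w).differentiableAt, by simp, ?_⟩
    rw [hd]
    exact (ih (by linarith)).neg

/-- The three-term recurrence; as `E_μ' = -E_{μ + 1}`, it is the differential equation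
`w E'' + (μ + 1) E' + E = 0` of `E = E_μ`. -/
theorem besselEntire_recurrence {μ : ℝ} (hμ : -1 < μ) (w : ℝ) :
    w * besselEntire (μ + 2) w - (μ + 1) * besselEntire (μ + 1) w + besselEntire μ w = 0 := by
  have h0 := (summable_besselCoeff_mul_pow hμ w).hasSum
  have h1 := (summable_besselCoeff_mul_pow (show -1 < μ + 1 by linarith) w).hasSum
  have h2 := (summable_besselCoeff_mul_pow (show -1 < μ + 2 by linarith) w).hasSum
  have h3 : HasSum (fun n : ℕ => -(n : ℝ) * besselCoeff (μ + 1) n * w ^ n)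
      (w * besselEntire (μ + 2) w) := by
    rw [← hasSum_nat_add_iff' 1]
    simp only [Finset.range_one, Finset.sum_singleton, Nat.cast_zero, neg_zero, zero_mul, sub_zero]
    convert! h2.mul_left w using 1
    funext n
    have := besselCoeff_succ (μ + 1) n
    rw [add_assoc, one_add_one_eq_two] at this
    push_cast
    linear_combination (-w ^ (n + 1)) * this
  have h4 : HasSum (fun _ : ℕ => (0 : ℝ))
      (w * besselEntire (μ + 2) w - (μ + 1) * besselEntire (μ + 1) w + besselEntire μ w) := by
    convert! (h3.sub (h1.mul_left (μ + 1))).add h0 using 1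
    funext n
    rw [← besselCoeff_add_one_param hμ n]
    ring
  exact h4.unique hasSum_zero

theorem besselEntire_zero (μ : ℝ) : besselEntire μ 0 = (Real.Gamma (μ + 1))⁻¹ := by
  rw [besselEntire, tsum_eq_single 0 (fun n hn => by simp [hn])]
  simp [besselCoeff]

/-! ### The solutions `u` and `v` as power series -/

theorem besselOrder_pos (k : ℕ) : 0 < besselOrder k := by
  unfold besselOrder; positivity

theorem besselOrder_mul (k : ℕ) : besselOrder k * (2 + (k : ℝ)) = 1 := by
  unfold besselOrder; field_simp

theorem besselOrder_le {k : ℕ} (hk : 2 ≤ k) : besselOrder k ≤ 1 / 4 := by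
  have : (2 : ℝ) ≤ k := by exact_mod_cast hk
  unfold besselOrder
  exact one_div_le_one_div_of_le (by norm_num) (by linarith)

/-- The function `√(π t / (2 + k)) J_ν(z(t))`, continued from `t > 0` to an entire function of `t`;
it is odd if `k` is even. -/
def airyOdd (k : ℕ) (t : ℝ) : ℝ :=
  √(Real.pi * besselOrder k) * besselOrder k ^ besselOrder k *
    (t * besselEntire (besselOrder k) (besselOrder k ^ 2 * t ^ (k + 2)))

/-- The function `√(π t / (2 + k)) J_{-ν}(z(t))`, continued from `t > 0` to an entire function of
`t`; it is even if `k` is even. -/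
def airyEven (k : ℕ) (t : ℝ) : ℝ :=
  √(Real.pi * besselOrder k) * besselOrder k ^ (-besselOrder k) *
    besselEntire (-besselOrder k) (besselOrder k ^ 2 * t ^ (k + 2))

theorem airyOdd_neg {k : ℕ} (hk : Even k) (t : ℝ) : airyOdd k (-t) = -airyOdd k t := by
  have : Even (k + 2) := hk.add (by decide)
  rw [airyOdd, airyOdd, this.neg_pow]
  ring

theorem airyEven_neg {k : ℕ} (hk : Even k) (t : ℝ) : airyEven k (-t) = airyEven k t := by
  have : Even (k + 2) := hk.add (by decide)
  rw [airyEven, airyEven, this.neg_pow]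

theorem half_liouville_variable (k : ℕ) (t : ℝ) :
    t ^ (1 + (k : ℝ) / 2) / (1 + (k : ℝ) / 2) / 2 = besselOrder k * t ^ (1 + (k : ℝ) / 2) := by
  have : (0 : ℝ) < 2 + k := by positivity
  unfold besselOrder
  field_simp

theorem sqrt_mul_besselJ (k : ℕ) (μ : ℝ) {t : ℝ} (ht : 0 < t) :
    √(Real.pi * t / (2 + k)) * besselJ μ (t ^ (1 + (k : ℝ) / 2) / (1 + (k : ℝ) / 2)) =
      √(Real.pi * besselOrder k) * besselOrder k ^ μ *
        (t ^ (1 / 2 + (1 + (k : ℝ) / 2) * μ) *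
          besselEntire μ (besselOrder k ^ 2 * t ^ (k + 2))) := by
  have h1 : Real.pi * t / (2 + k) = Real.pi * besselOrder k * t := by
    unfold besselOrder; ring
  have h2 : (t ^ (1 + (k : ℝ) / 2)) ^ 2 = t ^ (k + 2) := by
    rw [← Real.rpow_natCast, ← Real.rpow_mul ht.le, ← Real.rpow_natCast]
    congr 1
    push_cast
    ring
  have hν := besselOrder_pos k
  rw [besselJ_eq_rpow_mul_besselEntire, half_liouville_variable, mul_pow, h2, h1,
    Real.sqrt_mul (by positivity), Real.mul_rpow hν.le (by positivity), ← Real.rpow_mul ht.le,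
    Real.rpow_add ht, ← Real.sqrt_eq_rpow]
  ring

theorem sqrt_mul_besselJ_order (k : ℕ) {t : ℝ} (ht : 0 < t) :
    √(Real.pi * t / (2 + k)) *
      besselJ (besselOrder k) (t ^ (1 + (k : ℝ) / 2) / (1 + (k : ℝ) / 2)) = airyOdd k t := by
  have h := besselOrder_mul k
  have e : (1 : ℝ) / 2 + (1 + (k : ℝ) / 2) * besselOrder k = 1 := by linear_combination h / 2
  rw [sqrt_mul_besselJ k _ ht, e, Real.rpow_one, airyOdd]

theorem sqrt_mul_besselJ_neg_order (k : ℕ) {t : ℝ} (ht : 0 < t) :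
    √(Real.pi * t / (2 + k)) *
      besselJ (-besselOrder k) (t ^ (1 + (k : ℝ) / 2) / (1 + (k : ℝ) / 2)) = airyEven k t := by
  have h := besselOrder_mul k
  have e : (1 : ℝ) / 2 + (1 + (k : ℝ) / 2) * -besselOrder k = 0 := by linear_combination -h / 2
  rw [sqrt_mul_besselJ k _ ht, e, Real.rpow_zero, one_mul, airyEven]

theorem uEven_eq {k : ℕ} (hk : Even k) : uEven k = airyOdd k := by
  funext t
  unfold uEven
  split_ifs with h1 h2
  · exact sqrt_mul_besselJ_order k h1
  · have h := sqrt_mul_besselJ_order k (neg_pos.2 h2)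
    rw [mul_neg] at h
    rw [h, airyOdd_neg hk, neg_neg]
  · obtain rfl : t = 0 := le_antisymm (not_lt.1 h1) (not_lt.1 h2)
    simp [airyOdd]

theorem airyEven_zero (k : ℕ) :
    airyEven k 0 = √(Real.pi * besselOrder k) * besselOrder k ^ (-besselOrder k) *
      (Real.Gamma (1 - besselOrder k))⁻¹ := by
  rw [airyEven, zero_pow (by omega), mul_zero, besselEntire_zero, neg_add_eq_sub]

theorem sin_pi_mul_besselOrder_pos {k : ℕ} (hk : 0 < k) :
    0 < Real.sin (Real.pi * besselOrder k) := by
  have h1 := besselOrder_pos k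
  have h2 := besselOrder_mul k
  have hk' : (0 : ℝ) < k := by exact_mod_cast hk
  have h3 : besselOrder k < 1 := by nlinarith
  exact Real.sin_pos_of_pos_of_lt_pi (by positivity) (by nlinarith [Real.pi_pos])

/-- The value at `0` agrees with the one prescribed by the reflection formula for `Γ`. -/
theorem vEven_eq {k : ℕ} (hk0 : 0 < k) (hk : Even k) :
    vEven k = fun t => Real.cot (Real.pi * besselOrder k) * airyOdd k t -
      (Real.sin (Real.pi * besselOrder k))⁻¹ * airyEven k t := by
  funext t
  unfold vEven besselY
  split_ifs with h1 h2
  · rw [← sqrt_mul_besselJ_order k h1, ← sqrt_mul_besselJ_neg_order k h1]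
    ring
  · have h := sqrt_mul_besselJ_order k (neg_pos.2 h2)
    have h' := sqrt_mul_besselJ_neg_order k (neg_pos.2 h2)
    rw [airyOdd_neg hk, mul_neg] at h
    rw [airyEven_neg hk, mul_neg] at h'
    rw [← h', ← neg_eq_iff_eq_neg.2 h]
    ring
  · obtain rfl : t = 0 := le_antisymm (not_lt.1 h1) (not_lt.1 h2)
    have hs := (sin_pi_mul_besselOrder_pos hk0).ne'
    have hrefl := Real.Gamma_mul_Gamma_one_sub (besselOrder k)
    have hG : Real.Gamma (1 - besselOrder k) ≠ 0 := by
      intro h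
      rw [h, mul_zero] at hrefl
      exact (div_ne_zero Real.pi_ne_zero hs) hrefl.symm
    have e : Real.pi / (2 + k) = Real.pi * besselOrder k := by unfold besselOrder; ring
    have e0 : airyOdd k 0 = 0 := by simp [airyOdd]
    rw [airyEven_zero, e0, e]
    have hpi := Real.pi_ne_zero
    rw [eq_div_iff hs] at hrefl
    field_simp
    linear_combination -√(Real.pi * besselOrder k) * besselOrder k ^ (-besselOrder k) * hrefl

/-! ### The differential equation -/

theorem contDiff_airyOdd (k : ℕ) : ContDiff ℝ ∞ (airyOdd k) := by
  have := besselOrder_pos k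
  have h := contDiff_besselEntire (μ := besselOrder k) (by linarith)
  exact contDiff_const.mul (contDiff_id.mul
    (h.comp (contDiff_const.mul (contDiff_id.pow (k + 2)))))

theorem contDiff_airyEven {k : ℕ} (hk : 0 < k) : ContDiff ℝ ∞ (airyEven k) := by
  have h1 := besselOrder_pos k
  have h2 := besselOrder_mul k
  have hk' : (0 : ℝ) < k := by exact_mod_cast hk
  have h := contDiff_besselEntire (μ := -besselOrder k) (by nlinarith)
  exact contDiff_const.mul (h.comp (contDiff_const.mul (contDiff_id.pow (k + 2))))

theorem hasDerivAt_besselEntire_comp {μ : ℝ} (hμ : -1 < μ) (k : ℕ) (t : ℝ) :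
    HasDerivAt (fun t : ℝ => besselEntire μ (besselOrder k ^ 2 * t ^ (k + 2)))
      (-(besselOrder k * t ^ (k + 1) *
        besselEntire (μ + 1) (besselOrder k ^ 2 * t ^ (k + 2)))) t := by
  have h := (hasDerivAt_besselEntire hμ (besselOrder k ^ 2 * t ^ (k + 2))).comp t
    ((hasDerivAt_pow (k + 2) t).const_mul (besselOrder k ^ 2))
  convert! h using 1
  have := besselOrder_mul k
  rw [show k + 2 - 1 = k + 1 by omega]
  push_cast
  linear_combination (besselOrder k * t ^ (k + 1) *
    besselEntire (μ + 1) (besselOrder k ^ 2 * t ^ (k + 2))) * this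

theorem isSolution_of_hasDerivAt {q y y' : ℝ → ℝ} (h : ∀ t, HasDerivAt y (y' t) t)
    (h' : ∀ t, HasDerivAt y' (-(q t * y t)) t) : IsSolution q y := by
  have e : deriv y = y' := funext fun t => (h t).deriv
  exact ⟨fun t => (h t).differentiableAt, e ▸ h'⟩

theorem isSolution_airyOdd (k : ℕ) : IsSolution (fun t => t ^ k) (airyOdd k) := by
  have hν := besselOrder_pos k
  have hνk := besselOrder_mul k
  set ν := besselOrder k with hνdef
  have hd : ∀ μ : ℝ, -1 < μ → ∀ t : ℝ, _ := fun μ hμ t => hasDerivAt_besselEntire_comp hμ k t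
  rw [← hνdef] at hd
  refine isSolution_of_hasDerivAt (y' := fun t => √(Real.pi * ν) * ν ^ ν *
    (besselEntire ν (ν ^ 2 * t ^ (k + 2)) -
      ν * t ^ (k + 2) * besselEntire (ν + 1) (ν ^ 2 * t ^ (k + 2)))) (fun t => ?_) fun t => ?_
  · refine HasDerivAt.const_mul _ ?_
    convert! (hasDerivAt_id t).mul (hd ν (by linarith) t) using 1
    simp only [id]
    ring
  · have h1 := ((hd ν (by linarith) t).sub
      (((hasDerivAt_pow (k + 2) t).const_mul ν).mul (hd (ν + 1) (by linarith) t))).const_mul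
        (√(Real.pi * ν) * ν ^ ν)
    convert! h1 using 1
    have hrec := besselEntire_recurrence (μ := ν) (by linarith) (ν ^ 2 * t ^ (k + 2))
    rw [airyOdd, ← hνdef, show k + 2 - 1 = k + 1 by omega, show ν + 1 + 1 = ν + 2 by ring]
    push_cast
    linear_combination (√(Real.pi * ν) * ν ^ ν * t ^ (k + 1)) *
      (besselEntire (ν + 1) (ν ^ 2 * t ^ (k + 2)) * hνk - hrec)

theorem isSolution_airyEven {k : ℕ} (hk : 0 < k) : IsSolution (fun t => t ^ k) (airyEven k) := by
  have hν := besselOrder_pos k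
  have hνk := besselOrder_mul k
  have hk' : (0 : ℝ) < k := by exact_mod_cast hk
  set ν := besselOrder k with hνdef
  have hν1 : -1 < -ν := by nlinarith
  have hd : ∀ μ : ℝ, -1 < μ → ∀ t : ℝ, _ := fun μ hμ t => hasDerivAt_besselEntire_comp hμ k t
  rw [← hνdef] at hd
  refine isSolution_of_hasDerivAt (y' := fun t => √(Real.pi * ν) * ν ^ (-ν) *
    -(ν * t ^ (k + 1) * besselEntire (-ν + 1) (ν ^ 2 * t ^ (k + 2)))) (fun t => ?_) fun t => ?_
  · exact (hd (-ν) hν1 t).const_mul _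
  · have h1 := ((((hasDerivAt_pow (k + 1) t).const_mul ν).mul
      (hd (-ν + 1) (by linarith) t)).neg).const_mul (√(Real.pi * ν) * ν ^ (-ν))
    convert! h1 using 1
    have hrec := besselEntire_recurrence (μ := -ν) hν1 (ν ^ 2 * t ^ (k + 2))
    rw [airyEven, ← hνdef, show k + 1 - 1 = k by omega, show -ν + 1 + 1 = -ν + 2 by ring]
    push_cast
    linear_combination (√(Real.pi * ν) * ν ^ (-ν) * t ^ k) *
      (besselEntire (-ν + 1) (ν ^ 2 * t ^ (k + 2)) * hνk - hrec)

theorem IsSolution.const_mul {q y : ℝ → ℝ} (h : IsSolution q y) (c : ℝ) :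
    IsSolution q fun t => c * y t :=
  isSolution_of_hasDerivAt (fun t => (h.1 t).hasDerivAt.const_mul c) fun t => by
    convert! (h.2 t).const_mul c using 1
    ring

theorem IsSolution.sub {q y z : ℝ → ℝ} (hy : IsSolution q y) (hz : IsSolution q z) :
    IsSolution q fun t => y t - z t :=
  isSolution_of_hasDerivAt (fun t => (hy.1 t).hasDerivAt.sub (hz.1 t).hasDerivAt) fun t => by
    convert! (hy.2 t).sub (hz.2 t) using 1
    ring

/-- The Wronskian of two solutions is constant. -/
theorem IsSolution.wronskian_eq {q y z : ℝ → ℝ} (hy : IsSolution q y) (hz : IsSolution q z)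
    (t s : ℝ) : y t * deriv z t - deriv y t * z t = y s * deriv z s - deriv y s * z s := by
  have h : ∀ t, HasDerivAt (fun t => y t * deriv z t - deriv y t * z t) 0 t := fun t => by
    convert! ((hy.1 t).hasDerivAt.mul (hz.2 t)).sub ((hy.2 t).mul (hz.1 t).hasDerivAt) using 1
    ring
  exact is_const_of_deriv_eq_zero (fun t => (h t).differentiableAt) (fun t => (h t).deriv) t s

/-- Two solutions with Wronskian `1` form a basis of the space of solutions. -/
theorem IsSolution.existsUnique_coords {q u v y : ℝ → ℝ} (hu : IsSolution q u)
    (hv : IsSolution q v) (hW : ∀ t, u t * deriv v t - deriv u t * v t = 1)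
    (hy : IsSolution q y) : ∃! c : ℝ × ℝ, ∀ t, y t = c.1 * u t + c.2 * v t := by
  refine ⟨(y 0 * deriv v 0 - deriv y 0 * v 0, u 0 * deriv y 0 - deriv u 0 * y 0),
    fun t => ?_, ?_⟩
  · simp only
    rw [hy.wronskian_eq hv 0 t, hu.wronskian_eq hy 0 t]
    linear_combination (-y t) * hW t
  · rintro ⟨a, b⟩ h
    have hy' : deriv y 0 = a * deriv u 0 + b * deriv v 0 := by
      have e : y = fun t => a * u t + b * v t := funext h
      rw [e]
      exact (((hu.1 0).hasDerivAt.const_mul a).add ((hv.1 0).hasDerivAt.const_mul b)).deriv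
    have h0 := h 0
    have hW0 := hW 0
    simp only at h0
    ext
    · simp only
      rw [hy', h0]
      linear_combination (-a) * hW0
    · simp only
      rw [hy', h0]
      linear_combination (-b) * hW0

theorem isSolution_uEven {k : ℕ} (hk : Even k) : IsSolution (fun t => t ^ k) (uEven k) :=
  uEven_eq hk ▸ isSolution_airyOdd k

theorem isSolution_vEven {k : ℕ} (hk0 : 0 < k) (hk : Even k) :
    IsSolution (fun t => t ^ k) (vEven k) :=
  vEven_eq hk0 hk ▸ ((isSolution_airyOdd k).const_mul _).sub ((isSolution_airyEven hk0).const_mul _)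

theorem deriv_uEven_zero {k : ℕ} (hk : Even k) :
    deriv (uEven k) 0 = √(Real.pi * besselOrder k) * besselOrder k ^ besselOrder k *
      (Real.Gamma (besselOrder k + 1))⁻¹ := by
  have hν := besselOrder_pos k
  rw [uEven_eq hk]
  have h := (hasDerivAt_id (0 : ℝ)).mul (hasDerivAt_besselEntire_comp
    (μ := besselOrder k) (by linarith) k 0)
  have h' := h.const_mul (√(Real.pi * besselOrder k) * besselOrder k ^ besselOrder k)
  refine h'.deriv.trans ?_
  simp [besselEntire_zero]

theorem wronskian_uEven_vEven {k : ℕ} (hk0 : 0 < k) (hk : Even k) (t : ℝ) :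
    uEven k t * deriv (vEven k) t - deriv (uEven k) t * vEven k t = 1 := by
  rw [(isSolution_uEven hk).wronskian_eq (isSolution_vEven hk0 hk) t 0, deriv_uEven_zero hk]
  have hν := besselOrder_pos k
  have hG := (Real.Gamma_pos_of_pos hν).ne'
  have hpi := Real.pi_pos
  have e : Real.pi / (2 + k) = Real.pi * besselOrder k := by unfold besselOrder; ring
  have hs : √(Real.pi * besselOrder k) ^ 2 = Real.pi * besselOrder k :=
    Real.sq_sqrt (by positivity)
  have hp := Real.rpow_pos_of_pos hν (besselOrder k)
  simp only [uEven, vEven, lt_irrefl, if_false, e, zero_mul, zero_sub,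
    Real.Gamma_add_one hν.ne', Real.rpow_neg hν.le]
  field_simp
  linear_combination hs

/-! ### Gamma integrals along rays of the closed right half-plane -/

section GammaRays

open MeasureTheory ProbabilityTheory

theorem integrableOn_rpow_mul_exp_mul {a t : ℝ} (ha : 0 < a) (ht : t < 0) :
    IntegrableOn (fun r : ℝ => r ^ (a - 1) * Real.exp (t * r)) (Ioi 0) := by
  have h := integrableOn_rpow_mul_exp_neg_mul_rpow (s := a - 1) (p := 1) (by linarith) zero_lt_one
    (neg_pos.2 ht)
  simpa using h

/-- The Laplace transform of `r ^ (a - 1)` on the open right half-plane. The left side is analytic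
in `p`, because it is the moment generating function of the measure `r ^ (a - 1) dr` at `-p`, so
that the known case of positive real `p` suffices. -/
theorem integral_rpow_mul_cexp_neg_mul {a : ℝ} (ha : 0 < a) {p : ℂ} (hp : 0 < p.re) :
    ∫ r in Ioi (0 : ℝ), ((r ^ (a - 1) : ℝ) : ℂ) * Complex.exp (-(p * r)) =
      Real.Gamma a * p ^ (-(a : ℂ)) := by
  set μ : Measure ℝ := (volume.restrict (Ioi 0)).withDensity
    (fun r => ENNReal.ofReal (r ^ (a - 1))) with hμ
  have hmeas : Measurable fun r : ℝ => ENNReal.ofReal (r ^ (a - 1)) := by fun_prop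
  have hlt : ∀ᵐ r ∂volume.restrict (Ioi (0 : ℝ)), ENNReal.ofReal (r ^ (a - 1)) < ⊤ :=
    ae_of_all _ fun _ => ENNReal.ofReal_lt_top
  have hmgf : ∀ z : ℂ, complexMGF id μ z =
      ∫ r in Ioi (0 : ℝ), ((r ^ (a - 1) : ℝ) : ℂ) * Complex.exp (z * r) := by
    intro z
    rw [complexMGF, hμ, integral_withDensity_eq_integral_toReal_smul hmeas hlt]
    refine setIntegral_congr_fun measurableSet_Ioi fun r hr => ?_
    simp only [id, ENNReal.toReal_ofReal (Real.rpow_nonneg (le_of_lt hr) _), Complex.real_smul]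
  have hset : Iio (0 : ℝ) ⊆ interior (integrableExpSet id μ) := by
    refine interior_maximal (fun t ht => ?_) isOpen_Iio
    change Integrable (fun r => Real.exp (t * id r)) μ
    rw [hμ, integrable_withDensity_iff_integrable_smul' hmeas hlt]
    refine (integrableOn_rpow_mul_exp_mul ha ht).congr_fun (fun r hr => ?_) measurableSet_Ioi
    simp only [id, ENNReal.toReal_ofReal (Real.rpow_nonneg (le_of_lt hr) _), smul_eq_mul]
  set U : Set ℂ := {z | z.re < 0} with hU
  have hUo : IsOpen U := isOpen_lt Complex.continuous_re continuous_const
  have hUc : IsPreconnected U := (convex_halfSpace_re_lt 0).isPreconnected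
  have h1 : AnalyticOnNhd ℂ (complexMGF id μ) U := fun z hz => analyticAt_complexMGF (hset hz)
  have h2 : AnalyticOnNhd ℂ (fun z : ℂ => (Real.Gamma a : ℂ) * (-z) ^ (-(a : ℂ))) U := by
    refine DifferentiableOn.analyticOnNhd (fun z hz => ?_) hUo
    refine (DifferentiableAt.const_mul ?_ _).differentiableWithinAt
    refine differentiableAt_id.neg.cpow_const ?_
    left
    simpa [hU] using hz
  have hreal : ∀ t : ℝ, t < 0 →
      complexMGF id μ t = (Real.Gamma a : ℂ) * (-(t : ℂ)) ^ (-(a : ℂ)) := by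
    intro t ht
    have h := Complex.integral_cpow_mul_exp_neg_mul_Ioi (a := (a : ℂ)) (r := -t)
      (by simpa) (by linarith)
    have ht' : (0 : ℝ) ≤ -t := by linarith
    rw [hmgf, mul_comm, ← Complex.Gamma_ofReal]
    have e1 : (-(t : ℂ)) ^ (-(a : ℂ)) = (1 / ((-t : ℝ) : ℂ)) ^ (a : ℂ) := by
      rw [Complex.cpow_neg, one_div, ← Complex.ofReal_inv, ← Complex.ofReal_cpow (by positivity),
        ← Complex.ofReal_neg, ← Complex.ofReal_cpow ht', ← Complex.ofReal_inv,
        Real.inv_rpow ht']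
    rw [e1, ← h]
    refine setIntegral_congr_fun measurableSet_Ioi fun r hr => ?_
    rw [Complex.ofReal_cpow (le_of_lt hr)]
    push_cast
    ring_nf
  have hfreq : ∃ᶠ z in 𝓝[≠] (-1 : ℂ),
      complexMGF id μ z = (Real.Gamma a : ℂ) * (-z) ^ (-(a : ℂ)) := by
    have hT : Tendsto (fun t : ℝ => (t : ℂ)) (𝓝[≠] (-1)) (𝓝[≠] (-1)) := by
      refine tendsto_nhdsWithin_iff.2 ⟨?_, ?_⟩
      · exact (Complex.continuous_ofReal.tendsto' _ _ (by simp)).mono_left nhdsWithin_le_nhds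
      · filter_upwards [self_mem_nhdsWithin] with t ht h
        exact ht (Complex.ofReal_injective (by simpa using h))
    refine hT.frequently (Eventually.frequently ?_)
    filter_upwards [nhdsWithin_le_nhds (Iio_mem_nhds (show (-1 : ℝ) < 0 by norm_num))] with t ht
    exact hreal t ht
  have heq := h1.eqOn_of_preconnected_of_frequently_eq h2 hUc (z₀ := -1) (by simp [hU]) hfreq
  have := heq (show -p ∈ U by simpa [hU] using hp)
  simpa [hmgf] using this

theorem norm_one_sub_cexp_neg_le {z : ℂ} (hz : 0 ≤ z.re) : ‖1 - Complex.exp (-z)‖ ≤ 2 := by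
  refine (norm_sub_le _ _).trans ?_
  have : ‖Complex.exp (-z)‖ ≤ 1 := by
    rw [Complex.norm_exp]
    exact Real.exp_le_one_iff.2 (by simpa using hz)
  simp only [norm_one]
  linarith

theorem norm_one_sub_cexp_neg_le_norm {z : ℂ} (hz : 0 ≤ z.re) :
    ‖1 - Complex.exp (-z)‖ ≤ 2 * ‖z‖ := by
  rcases le_total ‖z‖ 1 with h | h
  · rw [norm_sub_rev]
    simpa using Complex.norm_exp_sub_one_le (x := -z) (by simpa using h)
  · linarith [norm_one_sub_cexp_neg_le hz]

/-- A common bound for the integrands `r ^ (a - 2) * (1 - exp (-p r))` with `‖p‖ ≤ 2`. -/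
def gammaRayBound (a r : ℝ) : ℝ := if r ≤ 1 then 4 * r ^ (a - 1) else 4 * r ^ (a - 2)

theorem integrableOn_gammaRayBound {a : ℝ} (ha : 0 < a) (ha1 : a < 1) :
    IntegrableOn (gammaRayBound a) (Ioi 0) := by
  rw [← Ioc_union_Ioi_eq_Ioi zero_le_one]
  refine IntegrableOn.union ?_ ?_
  · have h : IntegrableOn (fun r : ℝ => 4 * r ^ (a - 1)) (Ioc 0 1) :=
      ((intervalIntegrable_iff_integrableOn_Ioc_of_le zero_le_one).1
        (intervalIntegral.intervalIntegrable_rpow' (by linarith))).const_mul 4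
    exact h.congr_fun (fun r hr => by simp [gammaRayBound, hr.2]) measurableSet_Ioc
  · have h : IntegrableOn (fun r : ℝ => 4 * r ^ (a - 2)) (Ioi 1) :=
      (integrableOn_Ioi_rpow_of_lt (by linarith) one_pos).const_mul 4
    exact h.congr_fun (fun r hr => by simp [gammaRayBound, not_le.2 (mem_Ioi.1 hr)])
      measurableSet_Ioi

theorem norm_gammaRay_integrand_le (a : ℝ) {p : ℂ} (hp : 0 ≤ p.re) (hp2 : ‖p‖ ≤ 2) {r : ℝ}
    (hr : 0 < r) :
    ‖((r ^ (a - 2) : ℝ) : ℂ) * (1 - Complex.exp (-(p * r)))‖ ≤ gammaRayBound a r := by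
  have hre : 0 ≤ (p * r).re := by
    rw [Complex.re_mul_ofReal]; positivity
  have h1 := norm_one_sub_cexp_neg_le hre
  have h2 := norm_one_sub_cexp_neg_le_norm hre
  have hpos : 0 < r ^ (a - 2) := Real.rpow_pos_of_pos hr _
  rw [norm_mul, Complex.norm_real, Real.norm_of_nonneg hpos.le, gammaRayBound]
  split_ifs with h
  · have e : r ^ (a - 1) = r ^ (a - 2) * r := by
      rw [← Real.rpow_add_one hr.ne']; congr 1; ring
    rw [norm_mul, Complex.norm_real, Real.norm_of_nonneg hr.le] at h2
    rw [e]
    have : ‖p‖ * r ≤ 2 * r := by gcongr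
    nlinarith
  · nlinarith

theorem integrableOn_gammaRay_integrand {a : ℝ} (ha : 0 < a) (ha1 : a < 1) {p : ℂ}
    (hp : 0 ≤ p.re) (hp2 : ‖p‖ ≤ 2) :
    IntegrableOn (fun r : ℝ => ((r ^ (a - 2) : ℝ) : ℂ) * (1 - Complex.exp (-(p * r)))) (Ioi 0) := by
  refine (integrableOn_gammaRayBound ha ha1).mono' (Measurable.aestronglyMeasurable ?_) ?_
  · fun_prop
  · filter_upwards [ae_restrict_mem measurableSet_Ioi] with r hr
    exact norm_gammaRay_integrand_le a hp hp2 hr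

theorem intervalIntegrable_rpow_mul {a : ℝ} (ha : 0 < a) (x : ℝ) {f : ℝ → ℂ} (hf : Continuous f) :
    IntervalIntegrable (fun r : ℝ => ((r ^ (a - 1) : ℝ) : ℂ) * f r) volume 0 x := by
  refine IntervalIntegrable.mul_continuousOn ?_ hf.continuousOn
  have h : IntervalIntegrable (fun r : ℝ => r ^ (a - 1)) volume 0 x :=
    intervalIntegral.intervalIntegrable_rpow' (by linarith)
  exact ⟨h.1.ofReal, h.2.ofReal⟩

/-- Integration by parts with the antiderivative `(1 - exp (-p r)) / p`, which vanishes at `0`, of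
`exp (-p r)` turns the Gamma integral into an absolutely convergent one. -/
theorem integral_rpow_mul_cexp_by_parts {a : ℝ} (ha : 0 < a) (ha1 : a < 1) {p : ℂ}
    (hp : 0 ≤ p.re) (hp0 : p ≠ 0) (hp2 : ‖p‖ ≤ 2) {x : ℝ} (hx : 0 < x) :
    ∫ r in (0 : ℝ)..x, ((r ^ (a - 1) : ℝ) : ℂ) * Complex.exp (-(p * r)) =
      ((x ^ (a - 1) : ℝ) : ℂ) * ((1 - Complex.exp (-(p * x))) / p) +
      (1 - a) / p * ∫ r in (0 : ℝ)..x, ((r ^ (a - 2) : ℝ) : ℂ) * (1 - Complex.exp (-(p * r))) := by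
  have hi1 : IntervalIntegrable (fun r : ℝ => ((r ^ (a - 1) : ℝ) : ℂ) * Complex.exp (-(p * r)))
      volume 0 x := intervalIntegrable_rpow_mul ha x (by fun_prop)
  have hi2 : IntervalIntegrable
      (fun r : ℝ => ((r ^ (a - 2) : ℝ) : ℂ) * (1 - Complex.exp (-(p * r)))) volume 0 x :=
    (intervalIntegrable_iff_integrableOn_Ioc_of_le hx.le).2
      ((integrableOn_gammaRay_integrand ha ha1 hp hp2).mono_set Ioc_subset_Ioi_self)
  have hderiv : ∀ r : ℝ, 0 < r → HasDerivAt
      (fun r : ℝ => ((r ^ (a - 1) : ℝ) : ℂ) * ((1 - Complex.exp (-(p * r))) / p))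
      (((r ^ (a - 1) : ℝ) : ℂ) * Complex.exp (-(p * r)) -
        (1 - a) / p * (((r ^ (a - 2) : ℝ) : ℂ) * (1 - Complex.exp (-(p * r))))) r := by
    intro r hr
    have h1 : HasDerivAt (fun r : ℝ => ((r ^ (a - 1) : ℝ) : ℂ))
        ((((a - 1) * r ^ (a - 2) : ℝ)) : ℂ) r := by
      have := (Real.hasDerivAt_rpow_const (p := a - 1) (Or.inl hr.ne')).ofReal_comp
      rwa [show a - 1 - 1 = a - 2 by ring] at this
    have h2 : HasDerivAt (fun r : ℝ => Complex.exp (-(p * r)))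
        (Complex.exp (-(p * r)) * -(p * 1)) r :=
      ((Complex.ofRealCLM.hasDerivAt (x := r)).const_mul p).neg.cexp
    convert! h1.mul ((h2.const_sub 1).div_const p) using 1
    push_cast
    field_simp
    ring
  have h0 : Tendsto (fun r : ℝ => ((r ^ (a - 1) : ℝ) : ℂ) * ((1 - Complex.exp (-(p * r))) / p))
      (𝓝[>] 0) (𝓝 0) := by
    have hlim : Tendsto (fun r : ℝ => 2 * r ^ a) (𝓝[>] 0) (𝓝 0) := by
      have := ((Real.continuousAt_rpow_const 0 a (Or.inr ha.le)).tendsto.const_mul 2).mono_left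
        (nhdsWithin_le_nhds (s := Ioi 0))
      simpa [Real.zero_rpow ha.ne'] using this
    refine squeeze_zero_norm' ?_ hlim
    filter_upwards [self_mem_nhdsWithin] with r hr
    have hr : 0 < r := hr
    have hre : 0 ≤ (p * r).re := by
      rw [Complex.re_mul_ofReal]; positivity
    have hb := norm_one_sub_cexp_neg_le_norm hre
    rw [norm_mul, Complex.norm_real, Real.norm_of_nonneg hr.le] at hb
    have hpn : 0 < ‖p‖ := norm_pos_iff.2 hp0
    have hrp : 0 < r ^ (a - 1) := Real.rpow_pos_of_pos hr _
    have e : r ^ a = r ^ (a - 1) * r := by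
      rw [← Real.rpow_add_one hr.ne']; congr 1; ring
    rw [norm_mul, norm_div, Complex.norm_real, Real.norm_of_nonneg hrp.le, e]
    have : ‖1 - Complex.exp (-(p * r))‖ / ‖p‖ ≤ 2 * r := by
      rw [div_le_iff₀ hpn]; linarith
    nlinarith
  have hx' := (hderiv x hx).continuousAt.tendsto.mono_left (nhdsWithin_le_nhds (s := Iio x))
  have h := intervalIntegral.integral_eq_sub_of_hasDerivAt_of_tendsto hx
    (fun r hr => hderiv r hr.1) (hi1.sub (hi2.const_mul _)) h0 hx'
  rw [intervalIntegral.integral_sub hi1 (hi2.const_mul _), intervalIntegral.integral_const_mul,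
    sub_zero] at h
  rw [← h]
  ring

/-- Convergence on the whole closed half-plane except `0`. The limit is absolutely convergent, hence
continuous in `p` up to the boundary. -/
theorem tendsto_integral_rpow_mul_cexp_aux {a : ℝ} (ha : 0 < a) (ha1 : a < 1) {p : ℂ}
    (hp : 0 ≤ p.re) (hp0 : p ≠ 0) (hp2 : ‖p‖ ≤ 2) :
    Tendsto (fun x : ℝ => ∫ r in (0 : ℝ)..x, ((r ^ (a - 1) : ℝ) : ℂ) * Complex.exp (-(p * r))) atTop
      (𝓝 ((1 - a) / p *
        ∫ r in Ioi (0 : ℝ), ((r ^ (a - 2) : ℝ) : ℂ) * (1 - Complex.exp (-(p * r))))) := by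
  have h1 := (intervalIntegral_tendsto_integral_Ioi 0
    (integrableOn_gammaRay_integrand ha ha1 hp hp2) tendsto_id).const_mul ((1 - a) / p)
  have h2 : Tendsto (fun x : ℝ => ((x ^ (a - 1) : ℝ) : ℂ) * ((1 - Complex.exp (-(p * x))) / p))
      atTop (𝓝 0) := by
    have hlim : Tendsto (fun x : ℝ => x ^ (-(1 - a)) * (2 / ‖p‖)) atTop (𝓝 0) := by
      simpa using (tendsto_rpow_neg_atTop (show 0 < 1 - a by linarith)).mul_const (2 / ‖p‖)
    refine squeeze_zero_norm' ?_ hlim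
    filter_upwards [eventually_gt_atTop 0] with x hx
    have hre : 0 ≤ (p * x).re := by
      rw [Complex.re_mul_ofReal]; positivity
    have hb := norm_one_sub_cexp_neg_le hre
    rw [norm_mul, norm_div, Complex.norm_real, Real.norm_of_nonneg (by positivity), neg_sub]
    gcongr
  have h3 := h2.add h1
  rw [zero_add] at h3
  refine h3.congr' ?_
  filter_upwards [eventually_gt_atTop 0] with x hx
  exact (integral_rpow_mul_cexp_by_parts ha ha1 hp hp0 hp2 hx).symm

/-- The boundary case `p = I` of the Gamma integral: a conditionally convergent integral. -/
theorem tendsto_integral_rpow_mul_cexp_neg_I {a : ℝ} (ha : 0 < a) (ha1 : a < 1) :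
    Tendsto (fun x : ℝ => ∫ r in (0 : ℝ)..x,
        ((r ^ (a - 1) : ℝ) : ℂ) * Complex.exp (-(Complex.I * r))) atTop
      (𝓝 (Real.Gamma a * Complex.exp (-(Complex.I * (Real.pi * a / 2))))) := by
  have hI := tendsto_integral_rpow_mul_cexp_aux ha ha1 (p := Complex.I) (by simp) (by simp)
    (by simp)
  suffices h : (1 - a) / Complex.I *
      ∫ r in Ioi (0 : ℝ), ((r ^ (a - 2) : ℝ) : ℂ) * (1 - Complex.exp (-(Complex.I * r))) =
      Real.Gamma a * Complex.exp (-(Complex.I * (Real.pi * a / 2))) by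
    rwa [h] at hI
  -- Both sides are compared at `ε + I`, where the transform is known, and `ε` tends to `0`.
  set P : ℝ → ℂ := fun ε => ε + Complex.I with hP
  have hPre : ∀ ε : ℝ, (P ε).re = ε := by simp [hP]
  have hPne : ∀ ε : ℝ, P ε ≠ 0 := fun ε h => by simpa [hP] using congrArg Complex.im h
  have hPc : Continuous P := by fun_prop
  have hP0 : P 0 = Complex.I := by simp [hP]
  have hPn : ∀ ε ∈ Ioo (0 : ℝ) 1, ‖P ε‖ ≤ 2 := by
    intro ε hε
    refine (norm_add_le _ _).trans ?_
    rw [Complex.norm_real, Complex.norm_I, Real.norm_of_nonneg hε.1.le]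
    linarith [hε.2]
  have hmem : Ioo (0 : ℝ) 1 ∈ 𝓝[>] (0 : ℝ) := Ioo_mem_nhdsGT one_pos
  have key : ∀ ε ∈ Ioo (0 : ℝ) 1, (1 - a) / P ε *
      ∫ r in Ioi (0 : ℝ), ((r ^ (a - 2) : ℝ) : ℂ) * (1 - Complex.exp (-(P ε * r))) =
      Real.Gamma a * P ε ^ (-(a : ℂ)) := by
    intro ε hε
    have hre : 0 < (P ε).re := by rw [hPre]; exact hε.1
    refine tendsto_nhds_unique
      (tendsto_integral_rpow_mul_cexp_aux ha ha1 hre.le (hPne ε) (hPn ε hε)) ?_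
    rw [← integral_rpow_mul_cexp_neg_mul ha hre]
    refine intervalIntegral_tendsto_integral_Ioi 0 ?_ tendsto_id
    refine (integrableOn_rpow_mul_exp_mul ha (t := -ε) (by linarith [hε.1])).mono'
      (Measurable.aestronglyMeasurable (by fun_prop)) ?_
    filter_upwards [ae_restrict_mem measurableSet_Ioi] with r hr
    rw [norm_mul, Complex.norm_real, Real.norm_of_nonneg (Real.rpow_nonneg (le_of_lt hr) _),
      Complex.norm_exp, Complex.neg_re, Complex.re_mul_ofReal, hPre, neg_mul]
  have l1 : Tendsto (fun ε => (1 - a) / P ε *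
      ∫ r in Ioi (0 : ℝ), ((r ^ (a - 2) : ℝ) : ℂ) * (1 - Complex.exp (-(P ε * r)))) (𝓝[>] 0)
      (𝓝 ((1 - a) / Complex.I *
        ∫ r in Ioi (0 : ℝ), ((r ^ (a - 2) : ℝ) : ℂ) * (1 - Complex.exp (-(Complex.I * r))))) := by
    refine Tendsto.mul ?_ ?_
    · have : ContinuousAt (fun ε => (1 - a : ℂ) / P ε) 0 :=
        continuousAt_const.div hPc.continuousAt (hPne 0)
      simpa only [hP0] using this.tendsto.mono_left (nhdsWithin_le_nhds (s := Ioi 0))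
    · refine tendsto_integral_filter_of_dominated_convergence (gammaRayBound a) ?_ ?_
        (integrableOn_gammaRayBound ha ha1) ?_
      · exact .of_forall fun ε => Measurable.aestronglyMeasurable (by fun_prop)
      · filter_upwards [hmem] with ε hε
        filter_upwards [ae_restrict_mem measurableSet_Ioi] with r hr
        exact norm_gammaRay_integrand_le a (by rw [hPre]; exact hε.1.le) (hPn ε hε) hr
      · refine ae_of_all _ fun r => ?_
        have : Continuous fun ε => ((r ^ (a - 2) : ℝ) : ℂ) * (1 - Complex.exp (-(P ε * r))) := by
          fun_prop
        have h := (this.tendsto 0).mono_left (nhdsWithin_le_nhds (s := Ioi 0))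
        simpa only [hP0] using h
  have l2 : Tendsto (fun ε => (Real.Gamma a : ℂ) * P ε ^ (-(a : ℂ))) (𝓝[>] 0)
      (𝓝 (Real.Gamma a * Complex.I ^ (-(a : ℂ)))) := by
    have hc : ContinuousAt (fun ε => (Real.Gamma a : ℂ) * P ε ^ (-(a : ℂ))) 0 := by
      refine continuousAt_const.mul (hPc.continuousAt.cpow continuousAt_const ?_)
      rw [hP0]
      simp [Complex.mem_slitPlane_iff]
    simpa only [hP0] using hc.tendsto.mono_left (nhdsWithin_le_nhds (s := Ioi 0))
  have heq := tendsto_nhds_unique l1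
    (l2.congr' (by filter_upwards [hmem] with ε hε using (key ε hε).symm))
  rw [heq, Complex.cpow_def_of_ne_zero Complex.I_ne_zero, Complex.log_I]
  ring_nf

end GammaRays

/-! ### Poisson's integral -/

section Poisson

open MeasureTheory intervalIntegral

theorem ofReal_rpow_mul_one_sub_rpow {u v x : ℝ} (hx0 : 0 ≤ x) (hx1 : x ≤ 1) :
    (x : ℂ) ^ ((u : ℂ) - 1) * (1 - (x : ℂ)) ^ ((v : ℂ) - 1) =
      ((x ^ (u - 1) * (1 - x) ^ (v - 1) : ℝ) : ℂ) := by
  push_cast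
  rw [Complex.ofReal_cpow hx0, Complex.ofReal_cpow (by linarith)]
  push_cast
  rfl

theorem intervalIntegrable_rpow_mul_one_sub_rpow {u v : ℝ} (hu : 0 < u) (hv : 0 < v) :
    IntervalIntegrable (fun x : ℝ => x ^ (u - 1) * (1 - x) ^ (v - 1)) volume 0 1 := by
  have h := Complex.betaIntegral_convergent (u := (u : ℂ)) (v := (v : ℂ)) (by simpa) (by simpa)
  rw [intervalIntegrable_iff_integrableOn_Ioc_of_le zero_le_one] at h ⊢
  have h' : IntegrableOn (fun x : ℝ =>
      ((x : ℂ) ^ ((u : ℂ) - 1) * (1 - (x : ℂ)) ^ ((v : ℂ) - 1)).re) (Ioc 0 1) := h.re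
  refine h'.congr_fun (fun x hx => ?_) measurableSet_Ioc
  simp only
  rw [ofReal_rpow_mul_one_sub_rpow hx.1.le hx.2, Complex.ofReal_re]

theorem integral_rpow_mul_one_sub_rpow {u v : ℝ} (hu : 0 < u) (hv : 0 < v) :
    ∫ x in (0 : ℝ)..1, x ^ (u - 1) * (1 - x) ^ (v - 1) =
      Real.Gamma u * Real.Gamma v / Real.Gamma (u + v) := by
  have h : Complex.betaIntegral u v =
      ((∫ x in (0 : ℝ)..1, x ^ (u - 1) * (1 - x) ^ (v - 1) : ℝ) : ℂ) := by
    rw [Complex.betaIntegral, ← intervalIntegral.integral_ofReal]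
    refine intervalIntegral.integral_congr fun x hx => ?_
    rw [uIcc_of_le zero_le_one] at hx
    exact ofReal_rpow_mul_one_sub_rpow hx.1 hx.2
  have h2 := ProbabilityTheory.beta_eq_betaIntegralReal u v hu hv
  rw [h, Complex.ofReal_re] at h2
  exact h2.symm

theorem intervalIntegrable_one_sub_sq_rpow {a : ℝ} (ha : 0 < a) :
    IntervalIntegrable (fun s : ℝ => (1 - s ^ 2) ^ (a - 1)) volume 0 1 := by
  have h1 : IntervalIntegrable (fun s : ℝ => (1 - s) ^ (a - 1)) volume 0 1 := by
    have h : IntervalIntegrable (fun r : ℝ => r ^ (a - 1)) volume 0 1 :=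
      intervalIntegral.intervalIntegrable_rpow' (by linarith)
    simpa using (h.comp_sub_left 1).symm
  have h2 : ContinuousOn (fun s : ℝ => (1 + s) ^ (a - 1)) (uIcc 0 1) := by
    rw [uIcc_of_le zero_le_one]
    refine ContinuousOn.rpow_const (by fun_prop) fun s hs => Or.inl ?_
    linarith [hs.1]
  refine (h1.mul_continuousOn h2).congr fun s hs => ?_
  rw [uIoc_of_le zero_le_one] at hs
  rw [← Real.mul_rpow (by linarith [hs.2]) (by linarith [hs.1])]
  congr 1
  ring

/-- The moments of `(1 - s ^ 2) ^ (a - 1)` are Beta integrals in the variable `s ^ 2`. -/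
theorem integral_one_sub_sq_rpow_mul_pow {a : ℝ} (ha : 0 < a) (n : ℕ) :
    2 * ∫ s in (0 : ℝ)..1, (1 - s ^ 2) ^ (a - 1) * s ^ (2 * n) =
      Real.Gamma ((n : ℝ) + 1 / 2) * Real.Gamma a / Real.Gamma ((n : ℝ) + 1 / 2 + a) := by
  have hn : (0 : ℝ) < (n : ℝ) + 1 / 2 := by positivity
  rw [← integral_rpow_mul_one_sub_rpow hn ha, ← intervalIntegral.integral_const_mul]
  set g : ℝ → ℝ := fun x => x ^ ((n : ℝ) + 1 / 2 - 1) * (1 - x) ^ (a - 1) with hg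
  have hpt : ∀ s ∈ Ioc (0 : ℝ) 1,
      2 * ((1 - s ^ 2) ^ (a - 1) * s ^ (2 * n)) = (g ∘ fun s => s ^ 2) s * (2 * s) := by
    intro s hs
    have e : (s ^ 2) ^ ((n : ℝ) + 1 / 2 - 1) * s = s ^ (2 * n) := by
      rw [← Real.rpow_natCast s 2, ← Real.rpow_mul hs.1.le, ← Real.rpow_add_one hs.1.ne',
        ← Real.rpow_natCast]
      congr 1
      push_cast
      ring
    simp only [hg, Function.comp_apply, ← e]
    ring
  have himg : (fun s : ℝ => s ^ 2) '' uIcc 0 1 ⊆ Icc 0 1 := by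
    rw [uIcc_of_le zero_le_one]
    rintro _ ⟨s, hs, rfl⟩
    exact ⟨by positivity, pow_le_one₀ hs.1 hs.2⟩
  have himg' : ∀ x ∈ (fun s : ℝ => s ^ 2) '' Ioo (min 0 1) (max 0 1), 0 < x ∧ x < 1 := by
    rintro _ ⟨s, hs, rfl⟩
    rw [min_eq_left zero_le_one, max_eq_right zero_le_one] at hs
    exact ⟨pow_pos hs.1 2, pow_lt_one₀ hs.1.le hs.2 two_ne_zero⟩
  have hint := intervalIntegrable_rpow_mul_one_sub_rpow hn ha
  have h := intervalIntegral.integral_comp_mul_deriv''' (a := 0) (b := 1) (f := fun s : ℝ => s ^ 2)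
    (f' := fun s => 2 * s) (g := g) (by fun_prop)
    (fun s _ => by simpa using (hasDerivAt_pow 2 s).hasDerivWithinAt) ?_ ?_ ?_
  · simp only [one_pow, ne_eq, OfNat.ofNat_ne_zero, not_false_eq_true, zero_pow] at h
    rw [← h]
    refine intervalIntegral.integral_congr_ae (ae_of_all _ fun s hs => ?_)
    rw [uIoc_of_le zero_le_one] at hs
    exact hpt s hs
  · refine ContinuousOn.mul ?_ ?_
    · exact continuousOn_id.rpow_const fun x hx => Or.inl (himg' x hx).1.ne'
    · refine ContinuousOn.rpow_const (by fun_prop) fun x hx => Or.inl ?_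
      linarith [(himg' x hx).2]
  · refine IntegrableOn.mono_set ?_ himg
    rwa [integrableOn_Icc_iff_integrableOn_Ioc,
      ← intervalIntegrable_iff_integrableOn_Ioc_of_le zero_le_one]
  · rw [uIcc_of_le zero_le_one, integrableOn_Icc_iff_integrableOn_Ioc]
    have h1 : IntervalIntegrable (fun s : ℝ => 2 * ((1 - s ^ 2) ^ (a - 1) * s ^ (2 * n)))
        volume 0 1 :=
      ((intervalIntegrable_one_sub_sq_rpow ha).mul_continuousOn (by fun_prop)).const_mul 2
    rw [intervalIntegrable_iff_integrableOn_Ioc_of_le zero_le_one] at h1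
    exact h1.congr_fun hpt measurableSet_Ioc

theorem Gamma_nat_add_half_mul (n : ℕ) :
    Real.Gamma ((n : ℝ) + 1 / 2) * (4 ^ n * (n.factorial : ℝ)) =
      ((2 * n).factorial : ℝ) * √Real.pi := by
  induction n with
  | zero => simp [-one_div, Real.Gamma_one_half_eq]
  | succ n ih =>
    have e : ((n + 1 : ℕ) : ℝ) + 1 / 2 = ((n : ℝ) + 1 / 2) + 1 := by push_cast; ring
    rw [e, Real.Gamma_add_one (by positivity), show 2 * (n + 1) = 2 * n + 1 + 1 by ring,
      Nat.factorial_succ, Nat.factorial_succ, Nat.factorial_succ, pow_succ]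
    push_cast
    linear_combination (2 * (n : ℝ) + 1) * (2 * n + 2) * ih

/-- **Poisson's integral** for the Bessel functions, obtained by integrating the cosine series
term by term. -/
theorem besselEntire_eq_integral {a : ℝ} (ha : 0 < a) (x : ℝ) :
    √Real.pi * Real.Gamma a * besselEntire (a - 1 / 2) (x ^ 2 / 4) =
      2 * ∫ s in (0 : ℝ)..1, (1 - s ^ 2) ^ (a - 1) * Real.cos (x * s) := by
  have hI := intervalIntegrable_one_sub_sq_rpow ha
  have hsum : HasSum (fun n : ℕ => ∫ s in (0 : ℝ)..1,
      (1 - s ^ 2) ^ (a - 1) * ((-1) ^ n * (x * s) ^ (2 * n) / ((2 * n).factorial : ℝ)))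
      (∫ s in (0 : ℝ)..1, (1 - s ^ 2) ^ (a - 1) * Real.cos (x * s)) := by
    refine intervalIntegral.hasSum_integral_of_dominated_convergence
      (fun n s => (1 - s ^ 2) ^ (a - 1) * (|x| ^ (2 * n) / ((2 * n).factorial : ℝ))) ?_ ?_ ?_ ?_ ?_
    · intro n
      exact Measurable.aestronglyMeasurable (by fun_prop)
    · intro n
      refine ae_of_all _ fun s hs => ?_
      rw [uIoc_of_le zero_le_one] at hs
      have hs0 := hs.1.le
      have h1 : 0 ≤ 1 - s ^ 2 := by nlinarith [hs.1, hs.2]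
      rw [norm_mul, Real.norm_of_nonneg (Real.rpow_nonneg h1 _)]
      refine mul_le_mul_of_nonneg_left ?_ (Real.rpow_nonneg h1 _)
      rw [norm_div, norm_mul, norm_pow, norm_neg, norm_one, one_pow, one_mul, norm_pow, norm_mul,
        Real.norm_natCast, Real.norm_eq_abs, Real.norm_of_nonneg hs.1.le]
      gcongr
      exact mul_le_of_le_one_right (abs_nonneg x) hs.2
    · refine ae_of_all _ fun s _ => Summable.mul_left _ ?_
      exact (Real.hasSum_cosh |x|).summable
    · simp_rw [tsum_mul_left]
      exact hI.mul_const _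
    · exact ae_of_all _ fun s _ => (Real.hasSum_cos (x * s)).mul_left _
  have hw : -1 < a - 1 / 2 := by linarith
  have hterm : ∀ n : ℕ, 2 * ∫ s in (0 : ℝ)..1,
      (1 - s ^ 2) ^ (a - 1) * ((-1) ^ n * (x * s) ^ (2 * n) / ((2 * n).factorial : ℝ)) =
      √Real.pi * Real.Gamma a * (besselCoeff (a - 1 / 2) n * (x ^ 2 / 4) ^ n) := by
    intro n
    have e : ∀ s : ℝ,
        (1 - s ^ 2) ^ (a - 1) * ((-1) ^ n * (x * s) ^ (2 * n) / ((2 * n).factorial : ℝ)) =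
        ((-1) ^ n * x ^ (2 * n) / ((2 * n).factorial : ℝ)) *
          ((1 - s ^ 2) ^ (a - 1) * s ^ (2 * n)) := fun s => by
      rw [mul_pow]; ring
    simp_rw [e]
    rw [intervalIntegral.integral_const_mul, mul_left_comm, integral_one_sub_sq_rpow_mul_pow ha,
      besselCoeff, Real.Gamma_nat_eq_factorial, div_pow, ← pow_mul,
      show (n : ℝ) + (a - 1 / 2) + 1 = n + 1 / 2 + a by ring]
    have hG : 0 < Real.Gamma ((n : ℝ) + 1 / 2 + a) := Real.Gamma_pos_of_pos (by positivity)
    have h := Gamma_nat_add_half_mul n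
    have h1 : ((2 * n).factorial : ℝ) ≠ 0 := by positivity
    have h2 : (n.factorial : ℝ) ≠ 0 := by positivity
    generalize Real.Gamma ((n : ℝ) + 1 / 2) = G₁ at h ⊢
    generalize Real.Gamma ((n : ℝ) + 1 / 2 + a) = G₂ at hG ⊢
    field_simp
    linear_combination x ^ (2 * n) * h
  have h1 := hsum.mul_left 2
  simp_rw [hterm] at h1
  exact ((summable_besselCoeff_mul_pow hw (x ^ 2 / 4)).hasSum.mul_left _).unique h1

end Poisson

/-! ### Oscillatory integrals with an algebraic endpoint singularity -/

section Endpoint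

open MeasureTheory intervalIntegral

/-- The primitive of `r ^ (a - 1) * exp (-I r)` vanishing at `0`. -/
def oscPrimitive (a x : ℝ) : ℂ :=
  ∫ r in (0 : ℝ)..x, ((r ^ (a - 1) : ℝ) : ℂ) * Complex.exp (-(Complex.I * r))

theorem continuous_oscPrimitive {a : ℝ} (ha : 0 < a) : Continuous (oscPrimitive a) := by
  have h : ∀ x : ℝ, IntervalIntegrable
      (fun r : ℝ => ((r ^ (a - 1) : ℝ) : ℂ) * Complex.exp (-(Complex.I * r))) volume 0 x :=
    fun x => intervalIntegrable_rpow_mul ha x (by fun_prop)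
  exact intervalIntegral.continuous_primitive (fun x y => (h x).symm.trans (h y)) 0

theorem hasDerivAt_oscPrimitive {a x : ℝ} (ha : 0 < a) (hx : 0 < x) :
    HasDerivAt (oscPrimitive a)
      (((x ^ (a - 1) : ℝ) : ℂ) * Complex.exp (-(Complex.I * x))) x := by
  refine intervalIntegral.integral_hasDerivAt_right
    (intervalIntegrable_rpow_mul ha x (by fun_prop)) ?_ ?_
  · exact (Measurable.stronglyMeasurable (by fun_prop)).stronglyMeasurableAtFilter
  · refine ContinuousAt.mul ?_ (by fun_prop)
    exact Complex.continuous_ofReal.continuousAt.comp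
      (Real.continuousAt_rpow_const _ _ (Or.inl hx.ne'))

theorem exists_norm_oscPrimitive_le {a : ℝ} (ha : 0 < a) (ha1 : a < 1) :
    ∃ C, ∀ x, 0 ≤ x → ‖oscPrimitive a x‖ ≤ C := by
  obtain ⟨M, hM⟩ := eventually_atTop.1
    ((tendsto_integral_rpow_mul_cexp_neg_I ha ha1).norm.eventually (Iio_mem_nhds (lt_add_one _)))
  obtain ⟨C, hC⟩ := (isCompact_Icc (a := (0 : ℝ)) (b := M)).exists_bound_of_continuousOn
    (continuous_oscPrimitive ha).continuousOn
  refine ⟨max C (‖(Real.Gamma a : ℂ) * Complex.exp (-(Complex.I * (Real.pi * a / 2)))‖ + 1),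
    fun x hx => ?_⟩
  rcases le_total x M with h | h
  · exact (hC x ⟨hx, h⟩).trans (le_max_left _ _)
  · exact (le_of_lt (hM x h)).trans (le_max_right _ _)

/-- Integration by parts moves the derivative to the amplitude `h`, and the singular oscillating
factor is replaced by its bounded primitive. -/
theorem rpow_mul_integral_rpow_mul_cexp {a : ℝ} (ha : 0 < a) {h h' : ℝ → ℂ}
    (hh : ∀ r ∈ Icc (0 : ℝ) 1, HasDerivAt h (h' r) r) (hc : ContinuousOn h' (Icc 0 1))
    {x : ℝ} (hx : 0 < x) :
    ((x ^ a : ℝ) : ℂ) * ∫ r in (0 : ℝ)..1,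
        ((r ^ (a - 1) : ℝ) : ℂ) * (h r * Complex.exp (-(Complex.I * (x * r)))) =
      h 1 * oscPrimitive a x - ∫ r in (0 : ℝ)..1, h' r * oscPrimitive a (x * r) := by
  have hu : uIcc (0 : ℝ) 1 = Icc 0 1 := uIcc_of_le zero_le_one
  have hI : IntervalIntegrable (fun r : ℝ => ((x ^ a : ℝ) : ℂ) *
      (((r ^ (a - 1) : ℝ) : ℂ) * Complex.exp (-(Complex.I * (x * r))))) volume 0 1 :=
    (intervalIntegrable_rpow_mul ha 1 (by fun_prop)).const_mul _
  have h1 := intervalIntegral.integral_mul_deriv_eq_deriv_mul_of_hasDerivAt (a := 0) (b := 1)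
    (u := h) (u' := h') (v := fun r => oscPrimitive a (x * r))
    (v' := fun r : ℝ => ((x ^ a : ℝ) : ℂ) *
      (((r ^ (a - 1) : ℝ) : ℂ) * Complex.exp (-(Complex.I * (x * r)))))
    (hu ▸ fun r hr => (hh r hr).continuousAt.continuousWithinAt)
    ((continuous_oscPrimitive ha).comp (continuous_const.mul continuous_id)).continuousOn
    (fun r hr => hh r ?_) (fun r hr => ?_) ((hu.symm ▸ hc).intervalIntegrable) hI
  · have e0 : oscPrimitive a 0 = 0 := intervalIntegral.integral_same
    simp only [mul_zero, mul_one, e0, sub_zero] at h1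
    rw [← h1, ← intervalIntegral.integral_const_mul]
    congr 1
    funext r
    ring
  · rw [min_eq_left zero_le_one, max_eq_right zero_le_one] at hr
    exact Ioo_subset_Icc_self hr
  · rw [min_eq_left zero_le_one, max_eq_right zero_le_one] at hr
    have h2 := (hasDerivAt_oscPrimitive ha (mul_pos hx hr.1)).scomp r
      ((hasDerivAt_id r).const_mul x)
    convert! h2 using 1
    have e : x ^ a = x ^ (a - 1) * x := by
      rw [← Real.rpow_add_one hx.ne']; congr 1; ring
    rw [Real.mul_rpow hx.le hr.1.le, e]
    simp only [Complex.real_smul]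
    push_cast
    ring

/-- The contribution of the singular endpoint `0` dominates. -/
theorem tendsto_rpow_mul_integral_rpow_mul_cexp {a : ℝ} (ha : 0 < a) (ha1 : a < 1) {h h' : ℝ → ℂ}
    (hh : ∀ r ∈ Icc (0 : ℝ) 1, HasDerivAt h (h' r) r) (hc : ContinuousOn h' (Icc 0 1)) :
    Tendsto (fun x : ℝ => ((x ^ a : ℝ) : ℂ) * ∫ r in (0 : ℝ)..1,
        ((r ^ (a - 1) : ℝ) : ℂ) * (h r * Complex.exp (-(Complex.I * (x * r))))) atTop
      (𝓝 (h 0 * (Real.Gamma a * Complex.exp (-(Complex.I * (Real.pi * a / 2)))))) := by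
  set S : ℂ := Real.Gamma a * Complex.exp (-(Complex.I * (Real.pi * a / 2))) with hS
  have hu : uIcc (0 : ℝ) 1 = Icc 0 1 := uIcc_of_le zero_le_one
  have hi : IntervalIntegrable h' volume 0 1 := (hu.symm ▸ hc).intervalIntegrable
  have hK : Tendsto (oscPrimitive a) atTop (𝓝 S) := tendsto_integral_rpow_mul_cexp_neg_I ha ha1
  obtain ⟨C, hC⟩ := exists_norm_oscPrimitive_le ha ha1
  have h1 : Tendsto (fun x : ℝ => ∫ r in (0 : ℝ)..1, h' r * oscPrimitive a (x * r)) atTop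
      (𝓝 (∫ r in (0 : ℝ)..1, h' r * S)) := by
    refine intervalIntegral.tendsto_integral_filter_of_dominated_convergence
      (fun r => ‖h' r‖ * C) ?_ ?_ (hi.norm.mul_const C) ?_
    · refine .of_forall fun x => ?_
      refine AEStronglyMeasurable.mul ?_ ?_
      · rw [uIoc_of_le zero_le_one]
        exact (hc.mono Ioc_subset_Icc_self).aestronglyMeasurable measurableSet_Ioc
      · exact ((continuous_oscPrimitive ha).comp
          (continuous_const.mul continuous_id)).aestronglyMeasurable
    · filter_upwards [eventually_ge_atTop 0] with x hx
      refine ae_of_all _ fun r hr => ?_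
      rw [uIoc_of_le zero_le_one] at hr
      rw [norm_mul]
      exact mul_le_mul_of_nonneg_left (hC _ (mul_nonneg hx hr.1.le)) (norm_nonneg _)
    · refine ae_of_all _ fun r hr => ?_
      rw [uIoc_of_le zero_le_one] at hr
      exact (hK.comp (tendsto_id.atTop_mul_const hr.1)).const_mul _
  have hftc : ∫ r in (0 : ℝ)..1, h' r = h 1 - h 0 :=
    intervalIntegral.integral_eq_sub_of_hasDerivAt (hu.symm ▸ hh) hi
  have h2 := (hK.const_mul (h 1)).sub h1
  rw [intervalIntegral.integral_mul_const, hftc, ← sub_mul, sub_sub_cancel] at h2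
  refine h2.congr' ?_
  filter_upwards [eventually_gt_atTop 0] with x hx
  exact (rpow_mul_integral_rpow_mul_cexp ha hh hc hx).symm

/-- The substitution `s = 1 - r` moves the singular endpoint to `0`. -/
theorem integral_one_sub_sq_rpow_mul_cos {a : ℝ} (ha : 0 < a) (x : ℝ) :
    ∫ s in (0 : ℝ)..1, (1 - s ^ 2) ^ (a - 1) * Real.cos (x * s) =
      (Complex.exp (Complex.I * x) * ∫ r in (0 : ℝ)..1, ((r ^ (a - 1) : ℝ) : ℂ) *
        ((((2 - r) ^ (a - 1) : ℝ) : ℂ) * Complex.exp (-(Complex.I * (x * r))))).re := by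
  have hu : uIcc (0 : ℝ) 1 = Icc 0 1 := uIcc_of_le zero_le_one
  have hi : IntervalIntegrable (fun r : ℝ => Complex.exp (Complex.I * x) *
      (((r ^ (a - 1) : ℝ) : ℂ) *
      ((((2 - r) ^ (a - 1) : ℝ) : ℂ) * Complex.exp (-(Complex.I * (x * r)))))) volume 0 1 := by
    refine IntervalIntegrable.const_mul ?_ _
    have h : IntervalIntegrable (fun r : ℝ => r ^ (a - 1)) volume 0 1 :=
      intervalIntegral.intervalIntegrable_rpow' (by linarith)
    refine IntervalIntegrable.mul_continuousOn ⟨h.1.ofReal, h.2.ofReal⟩ ?_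
    refine ContinuousOn.mul ?_ (by fun_prop)
    refine Complex.continuous_ofReal.comp_continuousOn ?_
    refine ContinuousOn.rpow_const (by fun_prop) fun r hr => Or.inl ?_
    rw [hu] at hr
    linarith [hr.2]
  have hre := Complex.reCLM.intervalIntegral_comp_comm hi
  simp only [Complex.reCLM_apply] at hre
  rw [← intervalIntegral.integral_const_mul, ← hre]
  have hsub := intervalIntegral.integral_comp_sub_left (a := 0) (b := 1)
    (fun s : ℝ => (1 - s ^ 2) ^ (a - 1) * Real.cos (x * s)) 1
  rw [sub_self, sub_zero] at hsub
  rw [← hsub]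
  refine intervalIntegral.integral_congr fun r hr => ?_
  rw [hu] at hr
  have e1 : (1 - (1 - r) ^ 2) ^ (a - 1) = r ^ (a - 1) * (2 - r) ^ (a - 1) := by
    rw [← Real.mul_rpow hr.1 (by linarith [hr.2])]
    congr 1
    ring
  have e2 : Complex.exp (Complex.I * x) * (((r ^ (a - 1) : ℝ) : ℂ) *
      ((((2 - r) ^ (a - 1) : ℝ) : ℂ) * Complex.exp (-(Complex.I * (x * r))))) =
      ((r ^ (a - 1) * (2 - r) ^ (a - 1) : ℝ) : ℂ) *
        Complex.exp ((x * (1 - r) : ℝ) * Complex.I) := by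
    have e3 : Complex.exp (((x * (1 - r) : ℝ) : ℂ) * Complex.I) =
        Complex.exp (Complex.I * x) * Complex.exp (-(Complex.I * (x * r))) := by
      rw [← Complex.exp_add]
      congr 1
      push_cast
      ring
    rw [e3]
    push_cast
    ring
  rw [e1, e2, Complex.re_ofReal_mul, Complex.exp_ofReal_mul_I_re]

/-- The leading behaviour of Poisson's integral. -/
theorem tendsto_rpow_mul_integral_one_sub_sq_rpow_mul_cos {a : ℝ} (ha : 0 < a) (ha1 : a < 1) :
    Tendsto (fun x : ℝ => x ^ a * (∫ s in (0 : ℝ)..1, (1 - s ^ 2) ^ (a - 1) * Real.cos (x * s)) -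
      2 ^ (a - 1) * Real.Gamma a * Real.cos (x - Real.pi * a / 2)) atTop (𝓝 0) := by
  have hd : ∀ r ∈ Icc (0 : ℝ) 1, HasDerivAt (fun r : ℝ => (((2 - r) ^ (a - 1) : ℝ) : ℂ))
      (((-1 * (a - 1) * (2 - r) ^ (a - 1 - 1) : ℝ)) : ℂ) r := by
    intro r hr
    exact (((hasDerivAt_id r).const_sub 2).rpow_const (p := a - 1)
      (Or.inl (by simp only [id]; linarith [hr.2]))).ofReal_comp
  have hc : ContinuousOn (fun r : ℝ => (((-1 * (a - 1) * (2 - r) ^ (a - 1 - 1) : ℝ)) : ℂ))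
      (Icc 0 1) := by
    refine Complex.continuous_ofReal.comp_continuousOn (continuousOn_const.mul ?_)
    exact ContinuousOn.rpow_const (by fun_prop) fun r hr => Or.inl (by linarith [hr.2])
  have h := tendsto_rpow_mul_integral_rpow_mul_cexp ha ha1 hd hc
  rw [← tendsto_sub_nhds_zero_iff] at h
  have h0 := h.norm
  rw [norm_zero] at h0
  refine squeeze_zero_norm (fun x => ?_) h0
  -- The difference is the real part of the complex one, rotated by `exp (I x)`.
  have e1 : x ^ a * (∫ s in (0 : ℝ)..1, (1 - s ^ 2) ^ (a - 1) * Real.cos (x * s)) -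
      2 ^ (a - 1) * Real.Gamma a * Real.cos (x - Real.pi * a / 2) =
      (Complex.exp (Complex.I * x) * (((x ^ a : ℝ) : ℂ) *
        (∫ r in (0 : ℝ)..1, ((r ^ (a - 1) : ℝ) : ℂ) *
        ((((2 - r) ^ (a - 1) : ℝ) : ℂ) * Complex.exp (-(Complex.I * (x * r))))) -
        (((2 - 0) ^ (a - 1) : ℝ) : ℂ) *
          (Real.Gamma a * Complex.exp (-(Complex.I * (Real.pi * a / 2)))))).re := by
    have e2 : Complex.exp (Complex.I * x) * ((((2 - 0) ^ (a - 1) : ℝ) : ℂ) *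
        (Real.Gamma a * Complex.exp (-(Complex.I * (Real.pi * a / 2))))) =
        ((2 ^ (a - 1) * Real.Gamma a : ℝ) : ℂ) *
          Complex.exp (((x - Real.pi * a / 2 : ℝ) : ℂ) * Complex.I) := by
      have e3 : Complex.exp (((x - Real.pi * a / 2 : ℝ) : ℂ) * Complex.I) =
          Complex.exp (Complex.I * x) * Complex.exp (-(Complex.I * (Real.pi * a / 2))) := by
        rw [← Complex.exp_add]
        congr 1
        push_cast
        ring
      rw [e3, sub_zero]
      push_cast
      ring
    rw [mul_sub, Complex.sub_re, e2, Complex.re_ofReal_mul, Complex.exp_ofReal_mul_I_re,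
      mul_left_comm, Complex.re_ofReal_mul, integral_one_sub_sq_rpow_mul_cos ha]
  rw [e1]
  refine (Complex.abs_re_le_norm _).trans_eq ?_
  rw [norm_mul, mul_comm Complex.I, Complex.norm_exp_ofReal_mul_I, one_mul]

end Endpoint

/-! ### Asymptotics of the solutions -/

/-- As `J_μ(x) = (x / 2) ^ μ E_μ(x ^ 2 / 4)`, this is the leading behaviour
`√(2 / (π x)) cos (x - π a / 2)` of `J_μ` for `μ = a - 1 / 2`. -/
theorem tendsto_rpow_mul_besselEntire {a : ℝ} (ha : 0 < a) (ha1 : a < 1) :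
    Tendsto (fun x : ℝ => x ^ a * besselEntire (a - 1 / 2) (x ^ 2 / 4) -
      2 ^ a / √Real.pi * Real.cos (x - Real.pi * a / 2)) atTop (𝓝 0) := by
  have h := (tendsto_rpow_mul_integral_one_sub_sq_rpow_mul_cos ha ha1).const_mul
    (2 / (√Real.pi * Real.Gamma a))
  rw [mul_zero] at h
  refine h.congr fun x => ?_
  have hP := besselEntire_eq_integral ha x
  have hpi : 0 < √Real.pi := Real.sqrt_pos.2 Real.pi_pos
  have hG : 0 < Real.Gamma a := Real.Gamma_pos_of_pos ha
  have e : (2 : ℝ) ^ a = 2 ^ (a - 1) * 2 := by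
    rw [← Real.rpow_add_one two_ne_zero, sub_add_cancel]
  rw [e]
  generalize ∫ s in (0 : ℝ)..1, (1 - s ^ 2) ^ (a - 1) * Real.cos (x * s) = Y at hP ⊢
  generalize besselEntire (a - 1 / 2) (x ^ 2 / 4) = Z at hP ⊢
  field_simp
  linear_combination -x ^ a * hP

/-- The Liouville variable `z(t) = t ^ (1 + k / 2) / (1 + k / 2)`. -/
def liouvilleVar (k : ℕ) (t : ℝ) : ℝ := t ^ (1 + (k : ℝ) / 2) / (1 + (k : ℝ) / 2)

theorem tendsto_liouvilleVar (k : ℕ) : Tendsto (liouvilleVar k) atTop atTop := by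
  have h : (0 : ℝ) < 1 + (k : ℝ) / 2 := by positivity
  exact (tendsto_rpow_atTop h).atTop_div_const h

/-- The powers of `ν` and `2` cancel, and the amplitude is `t ^ (-k / 4)` for every order. -/
theorem tendsto_rpow_mul_sqrt_mul_besselJ (k : ℕ) {a : ℝ} (ha : 0 < a) (ha1 : a < 1) :
    Tendsto (fun t : ℝ => t ^ ((k : ℝ) / 4) *
        (√(Real.pi * t / (2 + k)) * besselJ (a - 1 / 2) (liouvilleVar k t)) -
      Real.cos (liouvilleVar k t - Real.pi * a / 2)) atTop (𝓝 0) := by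
  have hν := besselOrder_pos k
  have hpi := Real.pi_pos
  set ν := besselOrder k with hνdef
  have hs : √(Real.pi * ν) = √Real.pi * √ν := Real.sqrt_mul hpi.le ν
  have hspi : 0 < √Real.pi := Real.sqrt_pos.2 hpi
  have hν2 : √ν * ν ^ (a - 1 / 2) = ν ^ a := by
    rw [Real.sqrt_eq_rpow, ← Real.rpow_add hν]; congr 1; ring
  have h := ((tendsto_rpow_mul_besselEntire ha ha1).comp (tendsto_liouvilleVar k)).const_mul
    (√Real.pi / 2 ^ a)
  rw [mul_zero] at h
  refine h.congr' ?_
  filter_upwards [eventually_gt_atTop 0] with t ht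
  have hz : liouvilleVar k t = 2 * ν * t ^ (1 + (k : ℝ) / 2) := by
    have := half_liouville_variable k t
    rw [← hνdef] at this
    rw [liouvilleVar]
    linarith
  have hz2 : liouvilleVar k t ^ 2 / 4 = ν ^ 2 * t ^ (k + 2) := by
    have h2 : (t ^ (1 + (k : ℝ) / 2)) ^ 2 = t ^ (k + 2) := by
      rw [← Real.rpow_natCast, ← Real.rpow_mul ht.le, ← Real.rpow_natCast]
      congr 1
      push_cast
      ring
    rw [hz, mul_pow, h2]
    ring
  have hza : liouvilleVar k t ^ a = 2 ^ a * ν ^ a * t ^ ((1 + (k : ℝ) / 2) * a) := by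
    rw [hz, Real.mul_rpow (by positivity) (by positivity), Real.mul_rpow (by positivity) hν.le,
      ← Real.rpow_mul ht.le]
  have hexp : t ^ ((1 + (k : ℝ) / 2) * a) =
      t ^ ((k : ℝ) / 4) * t ^ (1 / 2 + (1 + (k : ℝ) / 2) * (a - 1 / 2)) := by
    rw [← Real.rpow_add ht]; congr 1; ring
  have hJ := sqrt_mul_besselJ k (a - 1 / 2) ht
  rw [← hνdef] at hJ
  have hJ' : √(Real.pi * t / (2 + k)) * besselJ (a - 1 / 2) (liouvilleVar k t) =
      √Real.pi * ν ^ a * (t ^ (1 / 2 + (1 + (k : ℝ) / 2) * (a - 1 / 2)) *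
        besselEntire (a - 1 / 2) (ν ^ 2 * t ^ (k + 2))) := by
    rw [liouvilleVar, hJ, hs, ← hν2]
    ring
  rw [hJ']
  simp only [Function.comp_apply]
  rw [hz2, hza, hexp]
  have h2a : (0 : ℝ) < 2 ^ a := by positivity
  field_simp

/-- The phase of the oscillations of `u` and `v` at `+∞`. -/
def oscPhase (k : ℕ) (t : ℝ) : ℝ := (k * Real.pi + 8 * t ^ (1 + (k : ℝ) / 2)) / (8 + 4 * k)

theorem liouvilleVar_eq_oscPhase (k : ℕ) (t : ℝ) :
    liouvilleVar k t - Real.pi * (1 / 2 + besselOrder k) / 2 = oscPhase k t - Real.pi / 2 := by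
  have : (0 : ℝ) < 2 + k := by positivity
  rw [liouvilleVar, oscPhase, besselOrder]
  field_simp
  ring

theorem tendsto_rpow_mul_uEven {k : ℕ} (hk0 : 0 < k) (hk : Even k) :
    Tendsto (fun t : ℝ => t ^ ((k : ℝ) / 4) * uEven k t - Real.sin (oscPhase k t)) atTop
      (𝓝 0) := by
  have hν := besselOrder_pos k
  obtain ⟨j, hj⟩ := hk
  have hν1 := besselOrder_le (k := k) (by omega)
  have h := tendsto_rpow_mul_sqrt_mul_besselJ k (a := 1 / 2 + besselOrder k) (by linarith)
    (by linarith)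
  refine h.congr' ?_
  filter_upwards [eventually_gt_atTop 0] with t ht
  rw [liouvilleVar_eq_oscPhase, Real.cos_sub_pi_div_two, add_sub_cancel_left, uEven, if_pos ht,
    liouvilleVar]

theorem tendsto_rpow_mul_vEven {k : ℕ} (hk0 : 0 < k) (hk : Even k) :
    Tendsto (fun t : ℝ => t ^ ((k : ℝ) / 4) * vEven k t + Real.cos (oscPhase k t)) atTop
      (𝓝 0) := by
  have hν := besselOrder_pos k
  have hs := (sin_pi_mul_besselOrder_pos hk0).ne'
  have hu := tendsto_rpow_mul_uEven hk0 hk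
  obtain ⟨j, hj⟩ := hk
  have hν1 := besselOrder_le (k := k) (by omega)
  have h := tendsto_rpow_mul_sqrt_mul_besselJ k (a := 1 / 2 - besselOrder k) (by linarith)
    (by linarith)
  have h1 := (hu.const_mul (Real.cot (Real.pi * besselOrder k))).sub
    (h.const_mul (Real.sin (Real.pi * besselOrder k))⁻¹)
  rw [mul_zero, mul_zero, sub_zero] at h1
  refine h1.congr' ?_
  filter_upwards [eventually_gt_atTop 0] with t ht
  have e1 : liouvilleVar k t - Real.pi * (1 / 2 - besselOrder k) / 2 =
      oscPhase k t + Real.pi * besselOrder k - Real.pi / 2 := by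
    have := liouvilleVar_eq_oscPhase k t
    linarith
  have e2 : (1 : ℝ) / 2 - besselOrder k - 1 / 2 = -besselOrder k := by ring
  rw [e1, e2, Real.cos_sub_pi_div_two, Real.sin_add, Real.cot_eq_cos_div_sin, uEven, vEven,
    if_pos ht, if_pos ht, besselY, Real.cot_eq_cos_div_sin, liouvilleVar]
  field_simp
  ring

/-- The leading behaviour at `+∞` of the quadratic forms in `u` and `v`. -/
theorem tendsto_rpow_mul_quadratic {k : ℕ} (hk0 : 0 < k) (hk : Even k) (P Q R : ℝ) :
    Tendsto (fun t : ℝ => t ^ ((k : ℝ) / 2) *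
        (P * uEven k t ^ 2 + Q * (uEven k t * vEven k t) + R * vEven k t ^ 2) -
      (P * Real.sin (oscPhase k t) ^ 2 - Q * (Real.sin (oscPhase k t) * Real.cos (oscPhase k t)) +
        R * Real.cos (oscPhase k t) ^ 2)) atTop (𝓝 0) := by
  have hu := tendsto_rpow_mul_uEven hk0 hk
  have hv := tendsto_rpow_mul_vEven hk0 hk
  have bs : IsBoundedUnder (· ≤ ·) atTop (norm ∘ fun t => Real.sin (oscPhase k t)) :=
    isBoundedUnder_of ⟨1, fun t => Real.abs_sin_le_one _⟩
  have bc : IsBoundedUnder (· ≤ ·) atTop (norm ∘ fun t => Real.cos (oscPhase k t)) :=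
    isBoundedUnder_of ⟨1, fun t => Real.abs_cos_le_one _⟩
  -- With `u = t ^ (-k / 4) (sin + x)` and `v = t ^ (-k / 4) (-cos + y)`, every term of the
  -- difference has a factor `x` or `y`.
  have h1 := (((hu.mul hu).const_mul P).add ((hu.zero_mul_isBoundedUnder_le bs).const_mul (2 * P)))
  have h2 := ((((hu.mul hv).add (hv.zero_mul_isBoundedUnder_le bs)).sub
    (hu.zero_mul_isBoundedUnder_le bc)).const_mul Q)
  have h3 := (((hv.mul hv).const_mul R).sub ((hv.zero_mul_isBoundedUnder_le bc).const_mul (2 * R)))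
  have h := (h1.add h2).add h3
  simp only [mul_zero, add_zero, sub_zero] at h
  refine h.congr' ?_
  filter_upwards [eventually_gt_atTop 0] with t ht
  have e : t ^ ((k : ℝ) / 2) = t ^ ((k : ℝ) / 4) * t ^ ((k : ℝ) / 4) := by
    rw [← Real.rpow_add ht]; congr 1; ring
  rw [e]
  ring

theorem uEven_neg {k : ℕ} (hk : Even k) (t : ℝ) : uEven k (-t) = -uEven k t := by
  rw [uEven_eq hk, airyOdd_neg hk]

theorem vEven_neg {k : ℕ} (hk0 : 0 < k) (hk : Even k) (t : ℝ) :
    vEven k (-t) = vEven k t - 2 * Real.cot (Real.pi * besselOrder k) * uEven k t := by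
  rw [uEven_eq hk, vEven_eq hk0 hk]
  simp only [airyOdd_neg hk, airyEven_neg hk]
  ring

/-! ### Oscillation excludes nonoscillation -/

/-- If `t ^ κ * g` is asymptotic to a trigonometric polynomial of `c * t ^ β + d` and `g` is
eventually antitone, then the trigonometric polynomial is constant: the values of `g` at the points
where the argument is `θ` modulo `2π` are compared with the values at the next points where it
is `θ'`. -/
theorem coeff_eq_zero_of_antitoneOn {g : ℝ → ℝ} {s : Set ℝ} (hs : s ∈ atTop)
    (hg : AntitoneOn g s) {κ β c d A B C : ℝ} (hβ : 0 < β) (hc : 0 < c)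
    (h : Tendsto (fun t : ℝ => t ^ κ * g t -
      (A + B * Real.cos (c * t ^ β + d) + C * Real.sin (c * t ^ β + d))) atTop (𝓝 0)) :
    B = 0 ∧ C = 0 := by
  set p : ℝ → ℝ := fun θ => A + B * Real.cos θ + C * Real.sin θ with hp
  have hper : ∀ (n : ℕ) (θ : ℝ), p (n * (2 * Real.pi) + θ) = p θ := fun n θ => by
    simp only [hp, add_comm _ θ, Real.cos_add_nat_mul_two_pi, Real.sin_add_nat_mul_two_pi]
  -- At `t = T θ n` the argument `c * t ^ β + d` equals `2πn + θ`.
  set y : ℝ → ℕ → ℝ := fun θ n => (n * (2 * Real.pi) + (θ - d)) / c with hy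
  set T : ℝ → ℕ → ℝ := fun θ n => y θ n ^ (β⁻¹) with hT
  have hyt : ∀ θ, Tendsto (y θ) atTop atTop := fun θ =>
    (tendsto_atTop_add_const_right _ _
      (tendsto_natCast_atTop_atTop.atTop_mul_const Real.two_pi_pos)).atTop_div_const hc
  have hTt : ∀ θ, Tendsto (T θ) atTop atTop := fun θ =>
    (tendsto_rpow_atTop (inv_pos.2 hβ)).comp (hyt θ)
  have hTp : ∀ θ, Tendsto (fun n => T θ n ^ κ * g (T θ n)) atTop (𝓝 (p θ)) := by
    intro θ
    have h1 := (h.comp (hTt θ)).add_const (p θ)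
    rw [zero_add] at h1
    refine h1.congr' ?_
    filter_upwards [(hyt θ).eventually_gt_atTop 0] with n hn
    have e : c * T θ n ^ β + d = n * (2 * Real.pi) + θ := by
      simp only [hT]
      rw [← Real.rpow_mul hn.le, inv_mul_cancel₀ hβ.ne', Real.rpow_one]
      simp only [hy]
      field_simp
      ring
    have e2 := hper n θ
    simp only [hp] at e2
    simp only [Function.comp_apply, e, hp, e2]
    ring
  have hratio : ∀ θ θ', Tendsto (fun n => (T θ n / T θ' n) ^ κ) atTop (𝓝 1) := by
    intro θ θ'
    have h1 : Tendsto (fun n => y θ n / y θ' n) atTop (𝓝 1) := by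
      have h2 : Tendsto (fun n => 1 + (θ - θ') / c / y θ' n) atTop (𝓝 (1 + 0)) :=
        ((hyt θ').const_div_atTop _).const_add 1
      rw [add_zero] at h2
      refine h2.congr' ?_
      filter_upwards [(hyt θ').eventually_gt_atTop 0] with n hn
      have e : y θ n = y θ' n + (θ - θ') / c := by
        simp only [hy]; ring
      rw [e, add_div, div_self hn.ne']
    have h3 : Tendsto (fun n => (y θ n / y θ' n) ^ (β⁻¹ * κ)) atTop (𝓝 (1 ^ (β⁻¹ * κ))) :=
      h1.rpow_const (Or.inl one_ne_zero)
    rw [Real.one_rpow] at h3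
    refine h3.congr' ?_
    filter_upwards [(hyt θ).eventually_gt_atTop 0, (hyt θ').eventually_gt_atTop 0] with n hn hn'
    simp only [hT]
    rw [← Real.div_rpow hn.le hn'.le, ← Real.rpow_mul (by positivity)]
  have hmono : ∀ θ θ', θ ≤ θ' → p θ' ≤ p θ := by
    intro θ θ' hθ
    have h1 := (hratio θ θ').mul (hTp θ')
    rw [one_mul] at h1
    refine le_of_tendsto_of_tendsto h1 (hTp θ) ?_
    filter_upwards [(hyt θ).eventually_gt_atTop 0, (hyt θ').eventually_gt_atTop 0,
      (hTt θ).eventually hs, (hTt θ').eventually hs] with n hn hn' hm hm'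
    have hle : T θ n ≤ T θ' n := by
      refine Real.rpow_le_rpow hn.le ?_ (inv_pos.2 hβ).le
      simp only [hy]
      gcongr
    have hpos : 0 < T θ n := Real.rpow_pos_of_pos hn _
    have hpos' : 0 < T θ' n := Real.rpow_pos_of_pos hn' _
    have hgle := hg hm hm' hle
    have e : (T θ n / T θ' n) ^ κ * (T θ' n ^ κ * g (T θ' n)) = T θ n ^ κ * g (T θ' n) := by
      rw [Real.div_rpow hpos.le hpos'.le]
      have := Real.rpow_pos_of_pos hpos' κ
      field_simp
    rw [e]
    exact mul_le_mul_of_nonneg_left hgle (Real.rpow_nonneg hpos.le _)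
  have hpi := Real.pi_pos
  have m1 := hmono 0 (Real.pi / 2) (by positivity)
  have m2 := hmono (Real.pi / 2) Real.pi (by linarith)
  have m3 := hmono Real.pi (Real.pi + Real.pi / 2) (by linarith)
  have m4 := hmono (Real.pi + Real.pi / 2) (2 * Real.pi) (by linarith)
  have s1 : Real.sin (Real.pi + Real.pi / 2) = -1 := by
    rw [add_comm, Real.sin_add_pi, Real.sin_pi_div_two]
  have c1 : Real.cos (Real.pi + Real.pi / 2) = 0 := by
    rw [add_comm, Real.cos_add_pi, Real.cos_pi_div_two, neg_zero]
  simp only [hp, Real.cos_zero, Real.sin_zero, Real.cos_pi_div_two, Real.sin_pi_div_two,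
    Real.cos_pi, Real.sin_pi, s1, c1, Real.cos_two_pi, Real.sin_two_pi] at m1 m2 m3 m4
  constructor <;> linarith

/-- The trigonometric polynomial of `coeff_eq_zero_of_antitoneOn` is not perturbed by passing from
`f` to an asymptotically equivalent function, because `t ^ κ * f` is bounded. -/
theorem coeff_eq_zero_of_nonoscillatoryAt {f : ℝ → ℝ} (hf : NonoscillatoryAt f atTop)
    {κ β c d A B C : ℝ} (hβ : 0 < β) (hc : 0 < c)
    (h : Tendsto (fun t : ℝ => t ^ κ * f t -
      (A + B * Real.cos (c * t ^ β + d) + C * Real.sin (c * t ^ β + d))) atTop (𝓝 0)) :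
    B = 0 ∧ C = 0 := by
  obtain ⟨g, ⟨s, hs, hmono⟩, hfg⟩ := hf
  have hbdd : (fun t : ℝ => t ^ κ * f t) =O[atTop] fun _ => (1 : ℝ) := by
    have h1 : (fun t : ℝ => A + B * Real.cos (c * t ^ β + d) + C * Real.sin (c * t ^ β + d))
        =O[atTop] fun _ => (1 : ℝ) := by
      refine IsBigO.of_bound (|A| + |B| + |C|) (.of_forall fun t => ?_)
      have hcos := Real.abs_cos_le_one (c * t ^ β + d)
      have hsin := Real.abs_sin_le_one (c * t ^ β + d)
      rw [norm_one, mul_one, Real.norm_eq_abs]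
      refine (abs_add_three _ _ _).trans ?_
      rw [abs_mul, abs_mul]
      nlinarith [abs_nonneg B, abs_nonneg C]
    simpa using (h.isBigO_one ℝ).add h1
  have hgf : (fun t : ℝ => t ^ κ * (g t - f t)) =o[atTop] fun _ => (1 : ℝ) :=
    ((isBigO_refl (fun t : ℝ => t ^ κ) atTop).mul_isLittleO hfg.symm.isLittleO).trans_isBigO hbdd
  have hg : Tendsto (fun t : ℝ => t ^ κ * g t -
      (A + B * Real.cos (c * t ^ β + d) + C * Real.sin (c * t ^ β + d))) atTop (𝓝 0) := by
    have h2 := h.add ((isLittleO_one_iff ℝ).1 hgf)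
    rw [add_zero] at h2
    refine h2.congr fun t => ?_
    ring
  rcases hmono with hm | hm
  · have h3 := coeff_eq_zero_of_antitoneOn (g := fun t => -g t) (κ := κ) (A := -A) (B := -B)
      (C := -C) (d := d) hs hm.neg hβ hc (by
        have h4 := hg.neg
        rw [neg_zero] at h4
        refine h4.congr fun t => ?_
        ring)
    simpa using h3
  · exact coeff_eq_zero_of_antitoneOn hs hm hβ hc hg

theorem NonoscillatoryAt.comp_neg {f : ℝ → ℝ} (hf : NonoscillatoryAt f atBot) :
    NonoscillatoryAt (fun t => f (-t)) atTop := by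
  obtain ⟨g, ⟨s, hs, hmono⟩, hfg⟩ := hf
  refine ⟨fun t => g (-t), ⟨Neg.neg ⁻¹' s, tendsto_neg_atTop_atBot hs, ?_⟩,
    hfg.comp_tendsto tendsto_neg_atTop_atBot⟩
  rcases hmono with hm | hm
  · exact Or.inr fun x hx y hy hxy => hm hy hx (neg_le_neg hxy)
  · exact Or.inl fun x hx y hy hxy => hm hy hx (neg_le_neg hxy)

theorem NonoscillatoryAt.neg {f : ℝ → ℝ} {l : Filter ℝ} (hf : NonoscillatoryAt f l) :
    NonoscillatoryAt (fun t => -f t) l := by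
  obtain ⟨g, ⟨s, hs, hmono⟩, hfg⟩ := hf
  refine ⟨fun t => -g t, ⟨s, hs, ?_⟩, hfg.neg⟩
  rcases hmono with hm | hm
  · exact Or.inr hm.neg
  · exact Or.inl hm.neg

theorem NonoscillatoryAt.inv {f : ℝ → ℝ} {l : Filter ℝ} (hf : NonoscillatoryAt f l)
    (hpos : ∀ t, 0 < f t) : NonoscillatoryAt (fun t => (f t)⁻¹) l := by
  obtain ⟨g, ⟨s, hs, hmono⟩, hfg⟩ := hf
  have hgpos : ∀ᶠ t in l, 0 < g t := by
    have h1 := hfg.symm.isLittleO.def (show (0 : ℝ) < 1 / 2 by norm_num)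
    filter_upwards [h1] with t ht
    have := hpos t
    simp only [Pi.sub_apply, Real.norm_eq_abs, abs_of_pos this] at ht
    linarith [(abs_le.1 ht).1]
  refine ⟨fun t => (g t)⁻¹, ⟨s ∩ {t | 0 < g t}, inter_mem hs hgpos, ?_⟩, hfg.inv⟩
  rcases hmono with hm | hm
  · exact Or.inr fun x hx y hy hxy => inv_anti₀ hx.2 (hm hx.1 hy.1 hxy)
  · exact Or.inl fun x hx y hy hxy => inv_anti₀ hy.2 (hm hx.1 hy.1 hxy)

/-! ### Quadratic forms and modulus functions -/

theorem two_mul_oscPhase (k : ℕ) (t : ℝ) :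
    2 * oscPhase k t = 16 / (8 + 4 * k) * t ^ (1 + (k : ℝ) / 2) +
      2 * (k * Real.pi) / (8 + 4 * k) := by
  rw [oscPhase]; ring

/-- A quadratic form in `u` and `v` that does not oscillate at `+∞` is a multiple of
`u ^ 2 + v ^ 2`. -/
theorem eq_of_nonoscillatoryAt_quadratic {k : ℕ} (hk0 : 0 < k) (hk : Even k) {P Q R : ℝ}
    (h : NonoscillatoryAt (fun t => P * uEven k t ^ 2 + Q * (uEven k t * vEven k t) +
      R * vEven k t ^ 2) atTop) : P = R ∧ Q = 0 := by
  have hβ : (0 : ℝ) < 1 + (k : ℝ) / 2 := by positivity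
  have hc : (0 : ℝ) < 16 / (8 + 4 * k) := by positivity
  have h1 := coeff_eq_zero_of_nonoscillatoryAt h (κ := (k : ℝ) / 2)
    (d := 2 * (k * Real.pi) / (8 + 4 * k)) (A := (P + R) / 2) (B := (R - P) / 2) (C := -Q / 2)
    hβ hc ?_
  · constructor <;> linarith [h1.1, h1.2]
  · refine (tendsto_rpow_mul_quadratic hk0 hk P Q R).congr fun t => ?_
    rw [← two_mul_oscPhase, Real.cos_two_mul, Real.sin_two_mul]
    linear_combination (-P) * Real.sin_sq_add_cos_sq (oscPhase k t)

theorem cos_pi_mul_besselOrder_pos (k : ℕ) (hk : 2 ≤ k) :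
    0 < Real.cos (Real.pi * besselOrder k) := by
  have h1 := besselOrder_pos k
  have h2 := besselOrder_le hk
  have hpi := Real.pi_pos
  refine Real.cos_pos_of_mem_Ioo ⟨?_, ?_⟩ <;> nlinarith

theorem uEven_sq_add_vEven_sq_neg {k : ℕ} (hk0 : 0 < k) (hk : Even k) (t : ℝ) :
    uEven k (-t) ^ 2 + vEven k (-t) ^ 2 =
      (1 + 4 * Real.cot (Real.pi * besselOrder k) ^ 2) * uEven k t ^ 2 +
        -4 * Real.cot (Real.pi * besselOrder k) * (uEven k t * vEven k t) +
        1 * vEven k t ^ 2 := by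
  rw [uEven_neg hk, vEven_neg hk0 hk]
  ring

theorem not_nonoscillatoryAt_atBot {k : ℕ} (hk0 : 0 < k) (hk : Even k) {c : ℝ} (hc : c ≠ 0) :
    ¬ NonoscillatoryAt (fun t => c * (uEven k t ^ 2 + vEven k t ^ 2)) atBot := by
  intro h
  have h1 := h.comp_neg
  simp only [uEven_sq_add_vEven_sq_neg hk0 hk] at h1
  set γ := Real.cot (Real.pi * besselOrder k) with hγ
  have h2 := (eq_of_nonoscillatoryAt_quadratic hk0 hk (P := c * (1 + 4 * γ ^ 2))
    (Q := c * (-4 * γ)) (R := c) (by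
      convert! h1 using 2
      ring)).2
  obtain ⟨j, hj⟩ := hk
  have hcos := (cos_pi_mul_besselOrder_pos k (by omega)).ne'
  have hsin := (sin_pi_mul_besselOrder_pos hk0).ne'
  have hγ0 : γ ≠ 0 := by
    rw [hγ, Real.cot_eq_cos_div_sin]
    exact div_ne_zero hcos hsin
  exact mul_ne_zero hc (mul_ne_zero (by norm_num) hγ0) h2

theorem isLittleO_rpow_neg_of_tendsto {κ : ℝ} {f p : ℝ → ℝ}
    (h : Tendsto (fun t : ℝ => t ^ κ * f t - p t) atTop (𝓝 0)) :
    (fun t : ℝ => f t - t ^ (-κ) * p t) =o[atTop] fun t : ℝ => t ^ (-κ) := by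
  refine (isLittleO_iff_tendsto' ?_).2 (h.congr' ?_)
  · filter_upwards [eventually_gt_atTop 0] with t ht h0
    exact absurd h0 (Real.rpow_pos_of_pos ht _).ne'
  · filter_upwards [eventually_gt_atTop 0] with t ht
    have := Real.rpow_pos_of_pos ht κ
    rw [Real.rpow_neg ht.le]
    field_simp

theorem isLittleO_modulusEven {k : ℕ} (hk0 : 0 < k) (hk : Even k) (c₁ c₂ : ℝ) :
    (fun t : ℝ => modulusEven k c₁ c₂ t - t ^ (-((k : ℝ) / 2)) *
      (c₁ ^ 2 * Real.sin (oscPhase k t) ^ 2 + c₂ ^ 2 * Real.cos (oscPhase k t) ^ 2))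
      =o[atTop] (fun t : ℝ => t ^ (-((k : ℝ) / 2))) := by
  refine isLittleO_rpow_neg_of_tendsto
    ((tendsto_rpow_mul_quadratic hk0 hk (c₁ ^ 2) 0 (c₂ ^ 2)).congr fun t => ?_)
  rw [modulusEven]
  ring

theorem nonoscillatoryAt_modulusEven {k : ℕ} (hk0 : 0 < k) (hk : Even k) {c₁ c₂ : ℝ}
    (hc : c₁ ^ 2 = c₂ ^ 2) (h0 : c₁ ≠ 0) : NonoscillatoryAt (modulusEven k c₁ c₂) atTop := by
  have hc1 : 0 < c₁ ^ 2 := by positivity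
  refine ⟨fun t => c₁ ^ 2 * t ^ (-((k : ℝ) / 2)), ⟨Ioi 0, Ioi_mem_atTop 0, Or.inr ?_⟩, ?_⟩
  · intro x hx y hy hxy
    refine mul_le_mul_of_nonneg_left ?_ hc1.le
    exact Real.rpow_le_rpow_of_nonpos hx hxy (neg_nonpos.2 (by positivity))
  · have h := isLittleO_modulusEven hk0 hk c₁ c₂
    refine ((isLittleO_const_mul_right_iff hc1.ne').2 h).congr_left fun t => ?_
    simp only [Pi.sub_apply]
    linear_combination -t ^ (-((k : ℝ) / 2)) * c₁ ^ 2 * Real.sin_sq_add_cos_sq (oscPhase k t) +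
      t ^ (-((k : ℝ) / 2)) * Real.cos (oscPhase k t) ^ 2 * hc

theorem modulusEven_one_isEquivalent_atBot {k : ℕ} (hk0 : 0 < k) (hk : Even k) :
    modulusEven k 1 1 ~[atBot] fun t : ℝ =>
      (-t) ^ (-((k : ℝ) / 2)) * (Real.sin (Real.pi / (k + 2)))⁻¹ ^ 2 *
        (-4 * Real.cos (Real.pi / (k + 2)) * Real.sin (4 * t * (-t) ^ ((k : ℝ) / 2) / (k + 2))
          + Real.cos (2 * Real.pi / (k + 2)) + 3) / 2 := by
  have hs := sin_pi_mul_besselOrder_pos hk0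
  have hc := cos_pi_mul_besselOrder_pos k (by obtain ⟨j, hj⟩ := hk; omega)
  have e1 : Real.pi / (k + 2) = Real.pi * besselOrder k := by rw [besselOrder]; ring
  have e2 : 2 * Real.pi / ((k : ℝ) + 2) = 2 * (Real.pi * besselOrder k) := by
    rw [besselOrder]; ring
  rw [e1, e2]
  set S := Real.sin (Real.pi * besselOrder k) with hS
  set C := Real.cos (Real.pi * besselOrder k) with hC
  have hSC : S ^ 2 + C ^ 2 = 1 := Real.sin_sq_add_cos_sq _
  set H : ℝ → ℝ := fun t => t ^ (-((k : ℝ) / 2)) * (S⁻¹ ^ 2 *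
    (-4 * C * Real.sin (4 * -t * t ^ ((k : ℝ) / 2) / (k + 2)) +
      Real.cos (2 * (Real.pi * besselOrder k)) + 3) / 2) with hH
  have htop : (fun t => modulusEven k 1 1 (-t)) ~[atTop] H := by
    have h1 : (fun t => modulusEven k 1 1 (-t) - H t) =o[atTop]
        fun t : ℝ => t ^ (-((k : ℝ) / 2)) := by
      refine isLittleO_rpow_neg_of_tendsto ((tendsto_rpow_mul_quadratic hk0 hk
        (1 + 4 * Real.cot (Real.pi * besselOrder k) ^ 2)
        (-4 * Real.cot (Real.pi * besselOrder k)) 1).congr' ?_)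
      filter_upwards [eventually_gt_atTop 0] with t ht
      have e3 : 4 * -t * t ^ ((k : ℝ) / 2) / (k + 2) =
          Real.pi / 2 - (2 * oscPhase k t + Real.pi * besselOrder k) := by
        have h4 : t ^ (1 + (k : ℝ) / 2) = t * t ^ ((k : ℝ) / 2) := by
          rw [Real.rpow_add ht, Real.rpow_one]
        have : (0 : ℝ) < 2 + k := by positivity
        rw [oscPhase, h4, besselOrder]
        field_simp
        ring
      have e5 : modulusEven k 1 1 (-t) = uEven k (-t) ^ 2 + vEven k (-t) ^ 2 := by
        rw [modulusEven]; ring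
      rw [e5, uEven_sq_add_vEven_sq_neg hk0 hk, e3, Real.sin_pi_div_two_sub,
        Real.cos_add, Real.cos_two_mul, Real.sin_two_mul, Real.cos_two_mul,
        Real.cot_eq_cos_div_sin, ← hS, ← hC]
      have hosc := Real.sin_sq_add_cos_sq (oscPhase k t)
      generalize Real.sin (oscPhase k t) = x at hosc ⊢
      generalize Real.cos (oscPhase k t) = y at hosc ⊢
      have key : (1 + 4 * (C / S) ^ 2) * x ^ 2 - -4 * (C / S) * (x * y) + 1 * y ^ 2 =
          S⁻¹ ^ 2 * (-4 * C * ((2 * y ^ 2 - 1) * C - 2 * x * y * S) + (2 * C ^ 2 - 1) + 3) / 2 := by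
        field_simp
        linear_combination 2 * (4 * C ^ 2 + S ^ 2) * hosc + 2 * hSC
      rw [key]
    refine h1.trans_isBigO ?_
    -- The bracket is at least `2 * (1 - C) ^ 2 > 0`.
    have hC1 : C < 1 := by nlinarith
    have hδ : 0 < S⁻¹ ^ 2 * (1 - C) ^ 2 := by
      have : 0 < 1 - C := by linarith
      positivity
    refine IsBigO.of_bound (S⁻¹ ^ 2 * (1 - C) ^ 2)⁻¹ ?_
    filter_upwards [eventually_gt_atTop 0] with t ht
    have hp := Real.rpow_pos_of_pos ht (-((k : ℝ) / 2))
    have hsin := Real.sin_le_one (4 * -t * t ^ ((k : ℝ) / 2) / (k + 2))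
    have hlow : S⁻¹ ^ 2 * (1 - C) ^ 2 ≤ S⁻¹ ^ 2 *
        (-4 * C * Real.sin (4 * -t * t ^ ((k : ℝ) / 2) / (k + 2)) +
          Real.cos (2 * (Real.pi * besselOrder k)) + 3) / 2 := by
      rw [Real.cos_two_mul, ← hC, mul_div_assoc]
      refine mul_le_mul_of_nonneg_left ?_ (by positivity)
      nlinarith
    rw [Real.norm_of_nonneg hp.le, inv_mul_eq_div, le_div_iff₀ hδ, hH, norm_mul,
      Real.norm_of_nonneg hp.le]
    exact mul_le_mul_of_nonneg_left (hlow.trans (Real.le_norm_self _)) hp.le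
  have h := htop.comp_tendsto tendsto_neg_atBot_atTop
  refine (h.congr_left (.of_forall fun t => ?_)).congr_right (.of_forall fun t => ?_)
  · simp only [Function.comp_apply, neg_neg]
  · simp only [Function.comp_apply, hH, neg_neg]
    ring

/-! ### Phase functions -/

theorem IsPhaseFunction.neg {q α : ℝ → ℝ} (h : IsPhaseFunction q α) :
    IsPhaseFunction q fun t => -α t where
  contDiff := h.contDiff.neg
  deriv_ne_zero t := by
    rw [deriv.fun_neg]
    exact neg_ne_zero.2 (h.deriv_ne_zero t)
  kummer t := by
    rw [← h.kummer t, deriv.fun_neg, iteratedDeriv_fun_neg, iteratedDeriv_fun_neg, neg_sq,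
      neg_div_neg_eq, mul_neg, neg_div_neg_eq]

/-- A phase function with positive derivative gives the two solutions `cos α / √α'` and
`sin α / √α'`. -/
theorem IsPhaseFunction.isSolution {q α : ℝ → ℝ} (h : IsPhaseFunction q α)
    (hpos : ∀ t, 0 < deriv α t) :
    IsSolution q (fun t => (√(deriv α t))⁻¹ * Real.cos (α t)) ∧
      IsSolution q (fun t => (√(deriv α t))⁻¹ * Real.sin (α t)) := by
  have hα : ∀ t, HasDerivAt α (deriv α t) t := fun t =>
    (h.contDiff.differentiable (by norm_num) t).hasDerivAt
  have hc1 : ContDiff ℝ 2 (deriv α) := ((contDiff_succ_iff_deriv (n := 2)).1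
    (by simpa [show (2 : WithTop ℕ∞) + 1 = 3 by norm_num] using h.contDiff)).2.2
  have hc2 : ContDiff ℝ 1 (deriv (deriv α)) := ((contDiff_succ_iff_deriv (n := 1)).1
    (by simpa [show (1 : WithTop ℕ∞) + 1 = 2 by norm_num] using hc1)).2.2
  have hp : ∀ t, HasDerivAt (deriv α) (deriv (deriv α) t) t := fun t =>
    (hc1.differentiable (by norm_num) t).hasDerivAt
  have hp' : ∀ t, HasDerivAt (deriv (deriv α)) (deriv (deriv (deriv α)) t) t := fun t =>
    (hc2.differentiable (by norm_num) t).hasDerivAt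
  have hkum : ∀ t, q t - deriv α t ^ 2 + 3 / 4 * (deriv (deriv α) t / deriv α t) ^ 2 -
      deriv (deriv (deriv α)) t / (2 * deriv α t) = 0 := by
    intro t
    have := h.kummer t
    simpa only [iteratedDeriv_succ, iteratedDeriv_zero] using this
  set p := deriv α with hpdef
  set p' := deriv p with hp'def
  set p'' := deriv p' with hp''def
  have hr : ∀ t, HasDerivAt (fun t => (√(p t))⁻¹) (-(p' t / (2 * p t)) * (√(p t))⁻¹) t := by
    intro t
    have hs : 0 < √(p t) := Real.sqrt_pos.2 (hpos t)
    convert! ((hp t).sqrt (hpos t).ne').inv hs.ne' using 1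
    have hsq := Real.sq_sqrt (hpos t).le
    have := hpos t
    rw [hsq]
    field_simp
  have hL : ∀ t, HasDerivAt (fun t => p' t / (2 * p t))
      ((p'' t * (2 * p t) - p' t * (2 * p' t)) / (2 * p t) ^ 2) t := fun t =>
    (hp' t).div ((hp t).const_mul 2) (mul_pos two_pos (hpos t)).ne'
  constructor
  · refine isSolution_of_hasDerivAt
      (y' := fun t => -(p' t / (2 * p t)) * (√(p t))⁻¹ * Real.cos (α t) +
      (√(p t))⁻¹ * (-Real.sin (α t) * p t)) (fun t => (hr t).mul (hα t).cos) fun t => ?_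
    convert! (((hL t).neg.mul (hr t)).mul (hα t).cos).add
      ((hr t).mul ((hα t).sin.neg.mul (hp t))) using 1
    have hk := hkum t
    have := hpos t
    have hq : q t = p t ^ 2 - 3 / 4 * (p' t / p t) ^ 2 + p'' t / (2 * p t) := by linarith
    simp only [Pi.mul_apply, Pi.neg_apply]
    rw [hq]
    generalize (√(p t))⁻¹ = r
    field_simp
    ring
  · refine isSolution_of_hasDerivAt
      (y' := fun t => -(p' t / (2 * p t)) * (√(p t))⁻¹ * Real.sin (α t) +
      (√(p t))⁻¹ * (Real.cos (α t) * p t)) (fun t => (hr t).mul (hα t).sin) fun t => ?_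
    convert! (((hL t).neg.mul (hr t)).mul (hα t).sin).add
      ((hr t).mul ((hα t).cos.mul (hp t))) using 1
    have hk := hkum t
    have := hpos t
    have hq : q t = p t ^ 2 - 3 / 4 * (p' t / p t) ^ 2 + p'' t / (2 * p t) := by linarith
    simp only [Pi.mul_apply, Pi.neg_apply]
    rw [hq]
    generalize (√(p t))⁻¹ = r
    field_simp
    ring

/-- The reciprocal of `α'` is a quadratic form in `u` and `v`. If it is nonoscillatory at `+∞`, it
is a nonzero multiple of `u ^ 2 + v ^ 2`, which oscillates at `-∞`. -/
theorem IsPhaseFunction.not_nonoscillatoryAt_of_pos {k : ℕ} (hk0 : 0 < k) (hk : Even k)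
    {α : ℝ → ℝ} (h : IsPhaseFunction (fun t => t ^ k) α) (hpos : ∀ t, 0 < deriv α t) :
    ¬ (NonoscillatoryAt (deriv α) atTop ∧ NonoscillatoryAt (deriv α) atBot) := by
  rintro ⟨htop, hbot⟩
  obtain ⟨h1, h2⟩ := h.isSolution hpos
  have hu := isSolution_uEven hk
  have hv := isSolution_vEven hk0 hk
  have hW := wronskian_uEven_vEven hk0 hk
  obtain ⟨⟨a, b⟩, hab, -⟩ := hu.existsUnique_coords hv hW h1
  obtain ⟨⟨c, d⟩, hcd, -⟩ := hu.existsUnique_coords hv hW h2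
  simp only at hab hcd
  have hinv : ∀ t, (deriv α t)⁻¹ = (a ^ 2 + c ^ 2) * uEven k t ^ 2 +
      2 * (a * b + c * d) * (uEven k t * vEven k t) + (b ^ 2 + d ^ 2) * vEven k t ^ 2 := by
    intro t
    have e : (deriv α t)⁻¹ = ((√(deriv α t))⁻¹ * Real.cos (α t)) ^ 2 +
        ((√(deriv α t))⁻¹ * Real.sin (α t)) ^ 2 := by
      rw [mul_pow, mul_pow, inv_pow, Real.sq_sqrt (hpos t).le]
      linear_combination -(deriv α t)⁻¹ * Real.sin_sq_add_cos_sq (α t)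
    rw [e, hab, hcd]
    ring
  have htop' := htop.inv hpos
  have hbot' := hbot.inv hpos
  simp only [hinv] at htop' hbot'
  obtain ⟨hPR, hQ⟩ := eq_of_nonoscillatoryAt_quadratic hk0 hk htop'
  rw [hQ, ← hPR] at hbot'
  have hP : a ^ 2 + c ^ 2 ≠ 0 := by
    intro h0
    have h3 := hinv 0
    rw [hQ, ← hPR, h0] at h3
    have h4 := inv_pos.2 (hpos 0)
    simp only [zero_mul, add_zero] at h3
    exact h4.ne' h3
  refine not_nonoscillatoryAt_atBot hk0 hk hP ?_
  convert! hbot' using 2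
  ring

theorem IsPhaseFunction.not_nonoscillatoryAt {k : ℕ} (hk0 : 0 < k) (hk : Even k)
    {α : ℝ → ℝ} (h : IsPhaseFunction (fun t => t ^ k) α) :
    ¬ (NonoscillatoryAt (deriv α) atTop ∧ NonoscillatoryAt (deriv α) atBot) := by
  have hcont : Continuous (deriv α) := h.contDiff.continuous_deriv (by norm_num)
  -- By the intermediate value theorem, `α'` has constant sign.
  have hsign : (∀ t, 0 < deriv α t) ∨ ∀ t, deriv α t < 0 := by
    by_contra hcon
    push Not at hcon
    obtain ⟨⟨x, hx⟩, ⟨y, hy⟩⟩ := hcon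
    obtain ⟨z, hz⟩ := mem_range_of_exists_le_of_exists_ge hcont ⟨x, hx⟩ ⟨y, hy⟩
    exact h.deriv_ne_zero z hz
  rcases hsign with hpos | hneg
  · exact h.not_nonoscillatoryAt_of_pos hk0 hk hpos
  · rintro ⟨htop, hbot⟩
    have e : deriv (fun t => -α t) = fun t => -deriv α t := funext fun t => deriv.fun_neg
    refine h.neg.not_nonoscillatoryAt_of_pos hk0 hk (fun t => ?_) ⟨?_, ?_⟩
    · rw [e]
      exact neg_pos.2 (hneg t)
    · rw [e]
      exact htop.neg
    · rw [e]
      exact hbot.neg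

end

/-! ### Solutions, modulus functions and phase functions of `y'' + t ^ k y = 0` -/

theorem mainTheorem1 (k : ℕ) (hk : 0 < k) (hk_even : Even k) :
    -- `u, v` is a smooth basis of the space of solutions, with Wronskian `1`
    (ContDiff ℝ ∞ (uEven k) ∧ ContDiff ℝ ∞ (vEven k) ∧
      IsSolution (fun t => t ^ k) (uEven k) ∧ IsSolution (fun t => t ^ k) (vEven k) ∧
      (∀ t, uEven k t * deriv (vEven k) t - deriv (uEven k) t * vEven k t = 1) ∧
      (∀ y : ℝ → ℝ, IsSolution (fun t => t ^ k) y →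
        ∃! c : ℝ × ℝ, ∀ t, y t = c.1 * uEven k t + c.2 * vEven k t)) ∧
    -- leading-order behaviour of the modulus functions at `+∞`, and at `-∞` if `c₁ = c₂ = 1`
    (∀ c₁ c₂ : ℝ,
      (fun t : ℝ => modulusEven k c₁ c₂ t - t ^ (-((k : ℝ) / 2)) *
        (c₁ ^ 2 * Real.sin ((k * Real.pi + 8 * t ^ (1 + (k : ℝ) / 2)) / (8 + 4 * k)) ^ 2
          + c₂ ^ 2 * Real.cos ((k * Real.pi + 8 * t ^ (1 + (k : ℝ) / 2)) / (8 + 4 * k)) ^ 2))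
        =o[atTop] (fun t : ℝ => t ^ (-((k : ℝ) / 2)))) ∧
    (modulusEven k 1 1 ~[atBot] fun t : ℝ =>
      (-t) ^ (-((k : ℝ) / 2)) * (Real.sin (Real.pi / (k + 2)))⁻¹ ^ 2 *
        (-4 * Real.cos (Real.pi / (k + 2)) * Real.sin (4 * t * (-t) ^ ((k : ℝ) / 2) / (k + 2))
          + Real.cos (2 * Real.pi / (k + 2)) + 3) / 2) ∧
    -- no modulus function `c₁² u² + c₂² v²` is nonoscillatory in both directions
    (∀ c₁ c₂ : ℝ, (c₁, c₂) ≠ (0, 0) →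
      (NonoscillatoryAt (modulusEven k c₁ c₂) atTop ↔ c₁ ^ 2 = c₂ ^ 2) ∧
      (c₁ ^ 2 = c₂ ^ 2 → ¬ NonoscillatoryAt (modulusEven k c₁ c₂) atBot) ∧
      ¬ (NonoscillatoryOn (modulusEven k c₁ c₂) (Ioi 0) ∧
          NonoscillatoryOn (modulusEven k c₁ c₂) (Iio 0))) ∧
    -- no phase function is nonoscillatory in both directions
    (∀ α : ℝ → ℝ, IsPhaseFunction (fun t => t ^ k) α →
      ¬ (NonoscillatoryAt (deriv α) atTop ∧ NonoscillatoryAt (deriv α) atBot) ∧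
      ¬ NonoscillatoryOn (deriv α) univ) := by
  have hu := isSolution_uEven hk_even
  have hv := isSolution_vEven hk hk_even
  have hW := wronskian_uEven_vEven hk hk_even
  refine ⟨⟨?_, ?_, hu, hv, hW, fun y hy => hu.existsUnique_coords hv hW hy⟩,
    isLittleO_modulusEven hk hk_even, modulusEven_one_isEquivalent_atBot hk hk_even, ?_, ?_⟩
  · rw [uEven_eq hk_even]
    exact contDiff_airyOdd k
  · rw [vEven_eq hk hk_even]
    exact (contDiff_const.mul (contDiff_airyOdd k)).sub
      (contDiff_const.mul (contDiff_airyEven hk))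
  · intro c₁ c₂ h0
    have htop : NonoscillatoryAt (modulusEven k c₁ c₂) atTop → c₁ ^ 2 = c₂ ^ 2 := by
      intro h
      refine (eq_of_nonoscillatoryAt_quadratic hk hk_even (Q := 0) ?_).1
      convert! h using 2 with t
      rw [modulusEven]
      ring
    have hne : c₁ ^ 2 = c₂ ^ 2 → c₁ ≠ 0 := by
      rintro h rfl
      have : c₂ = 0 := by simpa using h.symm
      exact h0 (by rw [this])
    have hbot : c₁ ^ 2 = c₂ ^ 2 → ¬ NonoscillatoryAt (modulusEven k c₁ c₂) atBot := by
      intro h hosc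
      refine not_nonoscillatoryAt_atBot hk hk_even (pow_ne_zero 2 (hne h)) ?_
      convert! hosc using 2 with t
      rw [modulusEven, ← h]
      ring
    exact ⟨⟨htop, fun h => nonoscillatoryAt_modulusEven hk hk_even h (hne h)⟩, hbot,
      fun h => hbot (htop h.1.atTop) h.2.atBot⟩
  · intro α hα
    have h := hα.not_nonoscillatoryAt hk hk_even
    exact ⟨h, fun hosc => h ⟨(hosc.mono (subset_univ (Ioi 0))).atTop,
      (hosc.mono (subset_univ (Iio 0))).atBot⟩⟩
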